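/- \textbf{Setting.} A public-coin (non-interactive) local protocol for $n$ users with input space $\mathcal X$ consists of a distribution $\mathcal D_{\mathrm{pub}}$ of a public random string $\gamma$, a local randomizer $R$, which on public string $\gamma$ and input $x\in\mathcal X$ sends a random message $R_\gamma(x)$, and a (possibly randomized) analyzer $A$. On a dataset $X=(x_1,\dots,x_n)$, one samples $\gamma\leftarrow\mathcal D_{\mathrm{pub}}$, all users apply the same randomizer independently of each other given $\gamma$, and the output is $P(X)=A(\gamma,R_\gamma(x_1),\dots,R_\gamma(x_n))\in\mathbb R$. For $\epsilon\ge 0$ the protocol is $(\epsilon,\delta)$-locally DP if for all inputs $x,x'$ and all events $S$, $$\Pr[(\gamma,R_\gamma(x))\in S]\le e^{\epsilon}\,\Pr[(\gamma,R_\gamma(x'))\in S]+\delta .$$ $\mathsf{CountDistinct}_{n,n}$ is the function that maps a dataset in $[n]^n$ to the number of its distinct elements. A protocol solves it with error $e$ if on every dataset $X\in[n]^n$, with probability at least $0.99$, $|P(X)-\mathsf{CountDistinct}_{n,n}(X)|\le e$. \textbf{Theorem.} \begin{enumerate} \item For $0\le\epsilon=O(1)$, no public-coin $(\epsilon,o(1/n))$-locally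 DP protocol solves $\mathsf{CountDistinct}_{n,n}$ with error $o(n)$. That is, for all sequences $\epsilon_n\ge 0$ with $\epsilon_n=O(1)$, $\delta_n=o(1/n)$ and $e_n=o(n)$, for all sufficiently large $n$ no public-coin $(\epsilon_n,\delta_n)$-locally DP protocol for $n$ users solves $\mathsf{CountDistinct}_{n,n}$ with error $e_n$. \item More generally, for $0\le\epsilon\le 0.49\ln n$ the error is $\Omega(n/e^{\epsilon})$: there are absolute constants $c>0$ and $N$ such that for all $n\ge N$ and all $0\le\epsilon\le 0.49\ln n$, no public-coin $(\epsilon,c/n)$-locally DP protocol for $n$ users solves $\mathsf{CountDistinct}_{n,n}$ with error $c\,n/e^{\epsilon}$. \item For every $n\ge 2$, the global sensitivity of $\mathsf{CountDistinct}_{n,n}$ (the supremum of its change between two datasets that differ, up to order, in the input of one user) is $1$. So, by 1., the gap between global sensitivity and error in the local model can be linear in $n$. \end{enumerate} -/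

import Mathlib

open Filter MeasureTheory ProbabilityTheory Asymptotics

universe u v

namespace LocalDP

/-- Two datasets of `n` user inputs are neighboring if, up to the order of the entries, they differ
in (at most) the input of a single user. -/
def Neighboring {n : ℕ} {X : Type*} (x x' : Fin n → X) : Prop :=
  ∃ (σ : Equiv.Perm (Fin n)) (i : Fin n), ∀ j, j ≠ i → x' j = x (σ j)

/-- `(ε, δ)`-differential privacy of a randomized function `Q` on datasets of `n` inputs, where
`Q x` is the law of the output on the dataset `x`. -/
def IsDP {n : ℕ} {X Z : Type*} [MeasurableSpace Z] (Q : (Fin n → X) → Measure Z)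
    (ε δ : ℝ) : Prop :=
  ∀ x x' : Fin n → X, Neighboring x x' → ∀ S : Set Z, MeasurableSet S →
    (Q x).real S ≤ Real.exp ε * (Q x').real S + δ

/-- The kernel that, on input `a`, samples the coordinates independently, the `i`-th one from
`κ i a`. -/
noncomputable def piKernel {n : ℕ} {A M : Type*} [MeasurableSpace A] [MeasurableSpace M]
    (κ : Fin n → Kernel A M) [∀ i, IsMarkovKernel (κ i)] : Kernel A (Fin n → M) where
  toFun a := Measure.pi fun i => κ i a
  measurable' := by
    refine Measurable.measure_of_isPiSystem_of_isProbabilityMeasure generateFrom_pi.symm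
      isPiSystem_pi ?_
    rintro _ ⟨t, ht, rfl⟩
    simp only [Measure.pi_pi]
    exact Finset.measurable_prod _ fun i _ =>
      (κ i).measurable_coe (ht i (Set.mem_univ i))

/-- A public-coin (non-interactive) local protocol with `n` users, input space `X`, public coins in
`Γ` and messages in `M`.  A public random string `γ` is drawn from `coin`; every user applies the
same local randomizer, which sends a message with law `randomizer x γ` on input `x`; the analyzer
sees `γ` and all messages and outputs a (possibly randomized) real number. -/
structure Protocol (n : ℕ) (X Γ M : Type*) [MeasurableSpace Γ] [MeasurableSpace M] where
  coin : Measure Γ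
  coin_prob : IsProbabilityMeasure coin
  randomizer : X → Kernel Γ M
  randomizer_markov : ∀ x, IsMarkovKernel (randomizer x)
  analyzer : Kernel (Γ × (Fin n → M)) ℝ
  analyzer_markov : IsMarkovKernel analyzer

attribute [instance] Protocol.coin_prob Protocol.randomizer_markov Protocol.analyzer_markov

namespace Protocol

variable {n : ℕ} {X Γ M : Type*} [MeasurableSpace Γ] [MeasurableSpace M]

/-- The joint law of the public coin and the message of a user with input `x`. -/
noncomputable def view (P : Protocol n X Γ M) (x : X) : Measure (Γ × M) :=
  P.coin ⊗ₘ P.randomizer x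

/-- The protocol is `(ε, δ)`-DP in the public-coin local model: the randomized function
`x ↦ (γ, R_γ(x))` of a single user's input is `(ε, δ)`-DP. -/
def IsLocallyDP (P : Protocol n X Γ M) (ε δ : ℝ) : Prop :=
  IsDP (n := 1) (fun x : Fin 1 → X => P.view (x 0)) ε δ

/-- The joint law of the public coin and all messages, on the dataset `x`: given the coin, the
users' messages are independent. -/
noncomputable def transcript (P : Protocol n X Γ M) (x : Fin n → X) :
    Measure (Γ × (Fin n → M)) :=
  P.coin ⊗ₘ piKernel fun i => P.randomizer (x i)

/-- The law of the output of the protocol on the dataset `x`. -/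
noncomputable def output (P : Protocol n X Γ M) (x : Fin n → X) : Measure ℝ :=
  (P.transcript x).bind P.analyzer

/-- The protocol computes `f` with error `e`: on every dataset, with probability at least `0.99`,
its output is within `e` of the true value. -/
def Solves (P : Protocol n X Γ M) (f : (Fin n → X) → ℝ) (e : ℝ) : Prop :=
  ∀ x : Fin n → X, 0.99 ≤ (P.output x).real {z | |z - f x| ≤ e}

end Protocol

/-- The number of distinct elements among the inputs of `n` users, from a universe of size `D`. -/
def countDistinct (n D : ℕ) (x : Fin n → Fin D) : ℝ :=
  ((Finset.univ.image x).card : ℝ)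

/-- `s` is the global sensitivity of `f`: the least upper bound of the change of `f` between
neighboring datasets. -/
def IsGlobalSensitivity {n : ℕ} {X : Type*} (f : (Fin n → X) → ℝ) (s : ℝ) : Prop :=
  IsLUB {d : ℝ | ∃ x x' : Fin n → X, Neighboring x x' ∧ d = |f x - f x'|} s

end LocalDP

/-! The lower bound compares two input distributions. In one, the `n` users draw independent uniform
elements. In the other, element `x` has probability `(1 + τ σ x) / n`, where `τ = e ^ (-ε / 2) / 8`
and the balanced signs `σ` depend on the protocol but not on the coin.

No analyzer can tell them apart well. Relative to the average message law, input `x` has a message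
density `r x`, and privacy bounds `r x` by `e ^ ε` up to mass `δ`. For suitable signs the truncated
densities behave as if orthogonal, so the perturbation of one message density has squared `L²` norm
at most `τ² e ^ ε / n = 1 / (64 n)`. Affinity (the integral of the square root of the density)
tensorizes over the users, so the `n` messages together move by at most `1 / 2` in `L¹`
(`exists_balanced_signs`, `integral_abs_prod_sub_one_le`, `exists_perturbation`).

The distinct count does tell them apart. Balance cancels the first-order change of the expected
number of missing elements `∑ (1 - p y) ^ n`, and convexity leaves a second-order gain of order `n
τ²`, that is `n / e ^ ε` (`missing_gap`). The count fluctuates only by `O(√n)` (`sum_deviation_le`),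
which is of smaller order when `ε ≤ 0.49 ln n`. An accurate protocol would thus yield a test that
contradicts the first half (`not_solves_countDistinct`). -/

namespace LocalDP

/-! ### Densities of single messages and of the transcript -/

section Densities

variable {Γ M : Type*} [MeasurableSpace Γ] [MeasurableSpace M]

instance {n : ℕ} (κ : Fin n → Kernel Γ M) [∀ i, IsMarkovKernel (κ i)] :
    IsMarkovKernel (piKernel κ) :=
  ⟨fun a => by
    change IsProbabilityMeasure (Measure.pi fun i => κ i a)
    infer_instance⟩

theorem piKernel_apply {n : ℕ} (κ : Fin n → Kernel Γ M) [∀ i, IsMarkovKernel (κ i)] (a : Γ) :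
    piKernel κ a = Measure.pi fun i => κ i a := rfl

/-- The uniform mixture of finitely many kernels. -/
noncomputable def avgKernel {X : Type*} [Fintype X] (κ : X → Kernel Γ M) : Kernel Γ M where
  toFun γ := (Fintype.card X : ENNReal)⁻¹ • ∑ x, κ x γ
  measurable' := by
    refine Measure.measurable_of_measurable_coe _ fun s hs => ?_
    simp only [Measure.smul_apply, Measure.finsetSum_apply, smul_eq_mul]
    exact (Finset.measurable_sum _ fun x _ => (κ x).measurable_coe hs).const_mul _

theorem avgKernel_apply {X : Type*} [Fintype X] (κ : X → Kernel Γ M) (γ : Γ) :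
    avgKernel κ γ = (Fintype.card X : ENNReal)⁻¹ • ∑ x, κ x γ := rfl

instance {X : Type*} [Fintype X] [Nonempty X] (κ : X → Kernel Γ M)
    [∀ x, IsMarkovKernel (κ x)] : IsMarkovKernel (avgKernel κ) :=
  ⟨fun γ => ⟨by
    rw [avgKernel_apply]
    simp only [Measure.smul_apply, Measure.finsetSum_apply, smul_eq_mul, measure_univ,
      Finset.sum_const, Finset.card_univ, nsmul_eq_mul, mul_one]
    exact ENNReal.inv_mul_cancel (by simp) (by simp)⟩⟩

theorem compProd_avgKernel {X : Type*} [Fintype X] [Nonempty X] (ρ : Measure Γ) [SFinite ρ]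
    (κ : X → Kernel Γ M) [∀ x, IsMarkovKernel (κ x)] :
    ρ ⊗ₘ avgKernel κ = (Fintype.card X : ENNReal)⁻¹ • ∑ x, ρ ⊗ₘ κ x := by
  ext s hs
  rw [Measure.compProd_apply hs]
  simp only [avgKernel_apply, Measure.smul_apply, Measure.finsetSum_apply, smul_eq_mul]
  rw [lintegral_const_mul _ (Finset.measurable_sum _ fun x _ =>
    Kernel.measurable_kernel_prodMk_left hs), lintegral_finsetSum _ fun x _ =>
    Kernel.measurable_kernel_prodMk_left hs]
  simp only [Measure.compProd_apply hs]

/-- Finitely many probability measures have densities with respect to their uniform mixture that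
add up to the number of measures everywhere. -/
theorem exists_density_of_mixture {X Ω : Type*} [Fintype X] [Nonempty X] [MeasurableSpace Ω]
    (V : X → Measure Ω) [∀ x, IsProbabilityMeasure (V x)] (μ : Measure Ω) [IsFiniteMeasure μ]
    (hμ : μ = (Fintype.card X : ENNReal)⁻¹ • ∑ x, V x) :
    ∃ r : X → Ω → ℝ, (∀ x, Measurable (r x)) ∧ (∀ x ω, 0 ≤ r x ω) ∧
      (∀ ω, ∑ x, r x ω = Fintype.card X) ∧
      ∀ x, V x = μ.withDensity fun ω => ENNReal.ofReal (r x ω) := by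
  have hc0 : (Fintype.card X : ENNReal) ≠ 0 := by simp
  have hct : (Fintype.card X : ENNReal) ≠ ⊤ := by simp
  have hsum : ∑ x, V x = (Fintype.card X : ENNReal) • μ := by
    rw [hμ, smul_smul, ENNReal.mul_inv_cancel hc0 hct, one_smul]
  have hac : ∀ x, V x ≪ μ := fun x => by
    intro s hs
    have h1 : (∑ x, V x) s = 0 := by rw [hsum]; simp [hs]
    rw [Measure.finsetSum_apply] at h1
    exact (Finset.sum_eq_zero_iff.1 h1) x (Finset.mem_univ x)
  set r0 : X → Ω → ENNReal := fun x => (V x).rnDeriv μ with hr0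
  have hr0m : ∀ x, Measurable (r0 x) := fun x => Measure.measurable_rnDeriv _ _
  have hwd : ∀ x, μ.withDensity (r0 x) = V x := fun x => Measure.withDensity_rnDeriv_eq _ _ (hac x)
  have hae : (fun ω => ∑ x, r0 x ω) =ᵐ[μ] fun _ => (Fintype.card X : ENNReal) := by
    refine (withDensity_eq_iff_of_sigmaFinite (Finset.measurable_sum _ fun x _ =>
      hr0m x).aemeasurable aemeasurable_const).1 ?_
    rw [withDensity_const, ← hsum]
    ext s hs
    rw [withDensity_apply _ hs, lintegral_finsetSum _ fun x _ => hr0m x, Measure.finsetSum_apply]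
    refine Finset.sum_congr rfl fun x _ => ?_
    rw [← withDensity_apply _ hs, hwd]
  classical
  set E : Set Ω := {ω | ∑ x, r0 x ω = (Fintype.card X : ENNReal)} with hE
  have hEm : MeasurableSet E :=
    measurableSet_eq_fun (Finset.measurable_sum _ fun x _ => hr0m x) measurable_const
  have hfin : ∀ ω ∈ E, ∀ x, r0 x ω ≠ ⊤ := fun ω hω x => by
    have h1 : ∑ x, r0 x ω ≠ ⊤ := by rw [show ∑ x, r0 x ω = _ from hω]; exact hct
    exact (ENNReal.sum_ne_top.1 h1) x (Finset.mem_univ x)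
  -- The derivatives have the right sum only almost everywhere. The value `1` off `E` restores the
  -- sum at every point, and with it the pointwise bound of each density by the number of inputs.
  refine ⟨fun x ω => if ω ∈ E then (r0 x ω).toReal else 1, fun x =>
    Measurable.ite hEm (hr0m x).ennreal_toReal measurable_const, fun x ω => ?_, fun ω => ?_,
    fun x => ?_⟩
  · dsimp only
    split_ifs <;> positivity
  · dsimp only
    by_cases h : ω ∈ E
    · simp only [h, if_true]
      rw [← ENNReal.toReal_sum fun x _ => hfin ω h x, show ∑ x, r0 x ω = _ from h]
      simp
    · simp [h]
  · rw [← hwd x]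
    refine withDensity_congr_ae ?_
    filter_upwards [hae] with ω hω
    have h : ω ∈ E := hω
    simp [h, ENNReal.ofReal_toReal (hfin ω h x)]

theorem lintegral_pi_prod {n : ℕ} (ν : Fin n → Measure M) [∀ i, IsProbabilityMeasure (ν i)]
    (f : Fin n → M → ENNReal) (hf : ∀ i, Measurable (f i)) :
    ∫⁻ m, ∏ i, f i (m i) ∂Measure.pi ν = ∏ i, ∫⁻ x, f i x ∂ν i := by
  have h := lintegral_prod_eq_prod_lintegral_of_indepFun (μ := Measure.pi ν) Finset.univ
    (fun i (m : Fin n → M) => f i (m i)) (iIndepFun_pi fun i => (hf i).aemeasurable)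
    (fun i => (hf i).comp (measurable_pi_apply i))
  rw [h]
  exact Finset.prod_congr rfl fun i _ => (measurePreserving_eval ν i).lintegral_comp (hf i)

/-- Densities of the single messages (jointly with the coin) multiply to the density of the vector
of conditionally independent messages. -/
theorem compProd_piKernel_eq_withDensity {n : ℕ} (ρ : Measure Γ) [IsProbabilityMeasure ρ]
    (κ : Fin n → Kernel Γ M) [∀ i, IsMarkovKernel (κ i)] (η : Kernel Γ M) [IsMarkovKernel η]
    (r : Fin n → Γ × M → ENNReal) (hr : ∀ i, Measurable (r i))
    (h : ∀ i, ρ ⊗ₘ κ i = (ρ ⊗ₘ η).withDensity (r i)) :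
    ρ ⊗ₘ piKernel κ =
      (ρ ⊗ₘ piKernel fun _ : Fin n => η).withDensity fun p => ∏ i, r i (p.1, p.2 i) := by
  have hprod : Measurable fun p : Γ × (Fin n → M) => ∏ i, r i (p.1, p.2 i) :=
    Finset.measurable_prod _ fun i _ => (hr i).comp (by fun_prop)
  -- The exceptional null set of coins depends on `B`, since `M` need not be countably generated. A
  -- rectangle involves only `n` such sets, and a π-λ argument then extends the identity from
  -- rectangles.
  have hslice : ∀ i (B : Set M), MeasurableSet B →
      (fun γ => κ i γ B) =ᵐ[ρ] fun γ => ∫⁻ m in B, r i (γ, m) ∂η γ := by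
    intro i B hB
    have hm : Measurable fun γ => ∫⁻ m in B, r i (γ, m) ∂η γ := by
      have : Measurable (Function.uncurry fun (γ : Γ) (m : M) =>
          B.indicator (fun m => r i (γ, m)) m) := by
        have h2 : (Function.uncurry fun (γ : Γ) (m : M) => B.indicator (fun m => r i (γ, m)) m)
            = (Set.univ ×ˢ B).indicator (r i) := by
          ext ⟨γ, m⟩
          by_cases hmB : m ∈ B <;> simp [Function.uncurry, hmB]
        rw [h2]
        exact (hr i).indicator (MeasurableSet.univ.prod hB)
      have h3 := this.lintegral_kernel_prod_right (κ := η)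
      simpa only [lintegral_indicator hB] using h3
    refine ae_eq_of_forall_setLIntegral_eq_of_sigmaFinite ((κ i).measurable_coe hB) hm ?_
    intro A hA _
    rw [← Measure.compProd_apply_prod hA hB, h i, withDensity_apply _ (hA.prod hB),
      Measure.setLIntegral_compProd (hr i) hA hB]
  have hrect : ∀ (A : Set Γ), MeasurableSet A → ∀ B : Fin n → Set M, (∀ i, MeasurableSet (B i)) →
      (ρ ⊗ₘ piKernel κ) (A ×ˢ Set.univ.pi B) =
      ((ρ ⊗ₘ piKernel fun _ : Fin n => η).withDensity fun p => ∏ i, r i (p.1, p.2 i))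
        (A ×ˢ Set.univ.pi B) := by
    intro A hA B hB
    have hBm : MeasurableSet (Set.univ.pi B) := MeasurableSet.univ_pi hB
    rw [Measure.compProd_apply_prod hA hBm, withDensity_apply _ (hA.prod hBm),
      Measure.setLIntegral_compProd hprod hA hBm]
    refine lintegral_congr_ae (ae_restrict_of_ae ?_)
    filter_upwards [ae_all_iff.2 fun i => hslice i (B i) (hB i)] with γ hγ
    simp only [piKernel_apply, Measure.pi_pi, hγ, Measure.restrict_pi_pi]
    have : ∀ i, IsFiniteMeasure ((η γ).restrict (B i)) := fun i => inferInstance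
    have h4 : ∀ m : Fin n → M, (Set.univ.pi B).indicator (fun m => ∏ i, r i (γ, m i)) m =
        ∏ i, (B i).indicator (fun m => r i (γ, m)) (m i) := by
      intro m
      by_cases hm : m ∈ Set.univ.pi B
      · rw [Set.indicator_of_mem hm]
        exact Finset.prod_congr rfl fun i _ =>
          (Set.indicator_of_mem (hm i (Set.mem_univ i)) fun m => r i (γ, m)).symm
      · rw [Set.indicator_of_notMem hm]
        simp only [Set.mem_pi, Set.mem_univ, true_imp_iff, not_forall] at hm
        obtain ⟨i, hi⟩ := hm
        exact (Finset.prod_eq_zero (Finset.mem_univ i) (Set.indicator_of_notMem hi _)).symm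
    rw [← Measure.restrict_pi_pi, ← lintegral_indicator hBm]
    simp only [h4]
    rw [lintegral_pi_prod (fun _ => η γ) (fun i => (B i).indicator fun m => r i (γ, m)) fun i =>
      ((hr i).comp measurable_prodMk_left).indicator (hB i)]
    exact Finset.prod_congr rfl fun i _ => (lintegral_indicator (hB i) _).symm
  have huniv : ∀ A : Set Γ, A ×ˢ (Set.univ : Set (Fin n → M)) =
      A ×ˢ Set.univ.pi fun _ : Fin n => (Set.univ : Set M) := fun A => by simp
  have hfin : IsFiniteMeasure
      ((ρ ⊗ₘ piKernel fun _ : Fin n => η).withDensity fun p => ∏ i, r i (p.1, p.2 i)) := by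
    refine ⟨?_⟩
    rw [← Set.univ_prod_univ, huniv, ← hrect _ .univ _ fun _ => .univ]
    exact measure_lt_top _ _
  refine Measure.ext_prod fun {A t} hA ht => ?_
  refine MeasurableSpace.induction_on_inter
    (C := fun t _ => (ρ ⊗ₘ piKernel κ) (A ×ˢ t) =
      ((ρ ⊗ₘ piKernel fun _ : Fin n => η).withDensity fun p => ∏ i, r i (p.1, p.2 i)) (A ×ˢ t))
    generateFrom_pi.symm isPiSystem_pi (by simp) ?_ ?_ ?_ t ht
  · rintro _ ⟨B, hB, rfl⟩
    exact hrect A hA B fun i => hB i (Set.mem_univ i)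
  · intro t ht ih
    have hc : A ×ˢ tᶜ = (A ×ˢ Set.univ) \ (A ×ˢ t) := by
      ext ⟨a, b⟩; simp; tauto
    have hsub : A ×ˢ t ⊆ A ×ˢ (Set.univ : Set (Fin n → M)) :=
      Set.prod_mono le_rfl (Set.subset_univ t)
    rw [hc, measure_sdiff hsub (hA.prod ht).nullMeasurableSet (measure_ne_top _ _),
      measure_sdiff hsub (hA.prod ht).nullMeasurableSet (measure_ne_top _ _), ih, huniv,
      hrect A hA _ fun _ => .univ]
  · intro f hd hf ih
    have hp : Pairwise (Function.onFun Disjoint fun i => A ×ˢ f i) := fun i j hij =>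
      Set.disjoint_left.2 fun x hx hy => Set.disjoint_left.1 (hd hij) hx.2 hy.2
    rw [Set.prod_iUnion, measure_iUnion hp fun i => hA.prod (hf i),
      measure_iUnion hp fun i => hA.prod (hf i)]
    exact tsum_congr ih

end Densities

/-! ### Affinity of product densities and the choice of signs -/

section Affinity

/-- With `s = √(1 + u + v)` and `y = s ^ 2 - 1`, the difference `s - (1 + y / 2 - y ^ 2 / 2)` equals
`(s - 1) ^ 2 * s * (s + 2) / 2`, which is nonnegative. Here `u` is the part controlled in `L²` and
`v` the part controlled only in `L¹`, so `v` may cost only a linear term; for `|v| > 1` the left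
side is negative. -/
theorem one_add_half_sub_le_sqrt {u v : ℝ} (h : 0 ≤ 1 + u + v) :
    1 + (u + v) / 2 - u ^ 2 - 2 * |v| ≤ √(1 + u + v) := by
  by_cases hv : |v| ≤ 1
  · set s := √(1 + u + v) with hs
    have hs0 : 0 ≤ s := Real.sqrt_nonneg _
    have hs2 : s ^ 2 = 1 + u + v := Real.sq_sqrt h
    have h1 : 0 ≤ (s - 1) ^ 2 * (s * (s + 2)) := by positivity
    have h2 : v ^ 2 ≤ |v| := by
      rw [← sq_abs]
      nlinarith [abs_nonneg v]
    have h3 : u + v = s ^ 2 - 1 := by linarith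
    have h4 : (s ^ 2 - 1) ^ 2 ≤ 2 * u ^ 2 + 2 * v ^ 2 := by
      rw [← h3]
      nlinarith [sq_nonneg (u - v)]
    rw [h3]
    nlinarith
  · push Not at hv
    have := Real.sqrt_nonneg (1 + u + v)
    nlinarith [sq_nonneg (u - 1 / 4), le_abs_self v]

/-- Weighted AM-GM for `|g - 1| * (g + 1)`. When `g ^ 2` has integral `1` over a probability space,
the last term integrates to at most `1 / 4`, and the first is a multiple of the squared Hellinger
distance. -/
theorem abs_sq_sub_one_le {g : ℝ} (hg : 0 ≤ g) :
    |g ^ 2 - 1| ≤ 4 * (g - 1) ^ 2 + (g + 1) ^ 2 / 16 := by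
  rw [show g ^ 2 - 1 = (g - 1) * (g + 1) by ring, abs_mul, abs_of_nonneg (by linarith : 0 ≤ g + 1),
    ← sq_abs (g - 1)]
  nlinarith [sq_nonneg (2 * |g - 1| - (g + 1) / 4)]

variable {Γ M : Type*} [MeasurableSpace Γ] [MeasurableSpace M]

theorem integrable_of_bounds {Ω : Type*} [MeasurableSpace Ω] {μ : Measure Ω} [IsFiniteMeasure μ]
    {f : Ω → ℝ} (hf : Measurable f) {C : ℝ} (h0 : ∀ ω, 0 ≤ f ω) (hC : ∀ ω, f ω ≤ C) :
    Integrable f μ :=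
  Integrable.of_bound hf.aestronglyMeasurable C
    (ae_of_all _ fun ω => by rw [Real.norm_of_nonneg (h0 ω)]; exact hC ω)

theorem integrable_integral_compProd {ρ : Measure Γ} [SFinite ρ] {η : Kernel Γ M}
    [IsSFiniteKernel η] {f : Γ × M → ℝ} (hf : Integrable f (ρ ⊗ₘ η)) :
    Integrable (fun γ => ∫ m, f (γ, m) ∂η γ) ρ :=
  Integrable.integral_compProd (κ := Kernel.const Unit ρ) (η := Kernel.prodMkLeft Unit η)
    (a := ()) hf

variable {n : ℕ} (ρ : Measure Γ) [IsProbabilityMeasure ρ] (η : Kernel Γ M) [IsMarkovKernel η]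

/-- Bernoulli's inequality for the integral of a product over conditionally independent messages. -/
theorem one_add_mul_le_integral_prod {g : Γ × M → ℝ} (hg : Measurable g) {C : ℝ}
    (h0 : ∀ ω, 0 ≤ g ω) (hC : ∀ ω, g ω ≤ C) :
    1 + n * (∫ ω, g ω ∂(ρ ⊗ₘ η) - 1) ≤
      ∫ p, ∏ i, g (p.1, p.2 i) ∂(ρ ⊗ₘ piKernel fun _ : Fin n => η) := by
  have hgi : Integrable g (ρ ⊗ₘ η) := integrable_of_bounds hg h0 hC
  have hPm : Measurable fun p : Γ × (Fin n → M) => ∏ i, g (p.1, p.2 i) :=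
    Finset.measurable_prod _ fun i _ => hg.comp (by fun_prop)
  have hPi : Integrable (fun p : Γ × (Fin n → M) => ∏ i, g (p.1, p.2 i))
      (ρ ⊗ₘ piKernel fun _ : Fin n => η) := by
    refine integrable_of_bounds hPm (C := C ^ n) (fun p => Finset.prod_nonneg fun i _ => h0 _)
      fun p => ?_
    calc ∏ i, g (p.1, p.2 i) ≤ ∏ _i : Fin n, C :=
          Finset.prod_le_prod (fun i _ => h0 _) fun i _ => hC _
      _ = C ^ n := by simp
  have hi : Integrable (fun γ => ∫ m, g (γ, m) ∂η γ) ρ := integrable_integral_compProd hgi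
  have hi2 : Integrable (fun γ => ∫ m, ∏ i, g (γ, m i) ∂(piKernel (fun _ : Fin n => η) γ)) ρ :=
    integrable_integral_compProd hPi
  rw [Measure.integral_compProd hgi, Measure.integral_compProd hPi]
  have h2 : 1 + n * (∫ γ, ∫ m, g (γ, m) ∂η γ ∂ρ - 1) =
      ∫ γ, (1 + n * (∫ m, g (γ, m) ∂η γ - 1)) ∂ρ := by
    rw [integral_add (by fun_prop) (by fun_prop), integral_const_mul,
      integral_sub hi (by fun_prop)]
    simp
  rw [h2]
  -- For a fixed coin the messages are independent and the integral is an `n`-th power. Bernoulli's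
  -- lower bound is affine in the base, so it survives averaging over the coin.
  refine integral_mono (by fun_prop) hi2 fun γ => ?_
  have h3 : ∫ m, ∏ i, g (γ, m i) ∂(piKernel (fun _ : Fin n => η) γ) =
      (∫ m, g (γ, m) ∂η γ) ^ n := by
    rw [piKernel_apply, integral_fintype_prod_eq_pow (fun m => g (γ, m)), Fintype.card_fin]
  have h4 : 0 ≤ ∫ m, g (γ, m) ∂η γ := integral_nonneg fun m => h0 _
  have h5 := one_add_mul_le_pow (a := ∫ m, g (γ, m) ∂η γ - 1) (by linarith) n
  rw [add_sub_cancel] at h5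
  dsimp only
  rw [h3]
  exact h5

/-- A density on the vector of conditionally independent messages that is a product is close to `1`
in `L¹` if the affinity of a factor with `1` is close to `1`. -/
theorem integral_abs_prod_sub_one_le {f : Γ × M → ℝ} (hf : Measurable f) {C : ℝ}
    (h0 : ∀ ω, 0 ≤ f ω) (hC : ∀ ω, f ω ≤ C)
    (h1 : ∫ p, ∏ i, f (p.1, p.2 i) ∂(ρ ⊗ₘ piKernel fun _ : Fin n => η) = 1) :
    ∫ p, |∏ i, f (p.1, p.2 i) - 1| ∂(ρ ⊗ₘ piKernel fun _ : Fin n => η) ≤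
      1 / 4 + 8 * n * (1 - ∫ ω, √(f ω) ∂(ρ ⊗ₘ η)) := by
  set ν := ρ ⊗ₘ piKernel fun _ : Fin n => η
  set G : Γ × (Fin n → M) → ℝ := fun p => ∏ i, √(f (p.1, p.2 i)) with hG
  have hB := one_add_mul_le_integral_prod (n := n) ρ η (g := fun ω => √(f ω)) (C := √C)
    (by fun_prop) (fun ω => Real.sqrt_nonneg _) (fun ω => Real.sqrt_le_sqrt (hC ω))
  have hG2 : ∀ p, ∏ i, f (p.1, p.2 i) = G p ^ 2 := fun p => by
    rw [hG, ← Finset.prod_pow]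
    exact Finset.prod_congr rfl fun i _ => (Real.sq_sqrt (h0 _)).symm
  have hG0 : ∀ p, 0 ≤ G p := fun p => Finset.prod_nonneg fun i _ => Real.sqrt_nonneg _
  have hGC : ∀ p, G p ≤ √C ^ n := fun p => by
    calc G p ≤ ∏ _i : Fin n, √C :=
          Finset.prod_le_prod (fun i _ => Real.sqrt_nonneg _) fun i _ => Real.sqrt_le_sqrt (hC _)
      _ = √C ^ n := by simp
  have hGm : Measurable G := Finset.measurable_prod _ fun i _ => by fun_prop
  have hGi : Integrable G ν := integrable_of_bounds hGm hG0 hGC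
  have hG2i : Integrable (fun p => G p ^ 2) ν :=
    integrable_of_bounds (hGm.pow_const 2) (C := (√C ^ n) ^ 2) (fun p => by positivity)
      fun p => pow_le_pow_left₀ (hG0 p) (hGC p) 2
  simp only [hG2] at h1 ⊢
  have e1 : ∫ p, (G p - 1) ^ 2 ∂ν = 2 - 2 * ∫ p, G p ∂ν := by
    have : ∀ p, (G p - 1) ^ 2 = G p ^ 2 - 2 * G p + 1 := fun p => by ring
    simp only [this]
    rw [integral_add (by fun_prop) (by fun_prop), integral_sub hG2i (by fun_prop),
      integral_const_mul, h1]
    simp; ring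
  have e2 : 0 ≤ ∫ p, (G p - 1) ^ 2 ∂ν := integral_nonneg fun p => sq_nonneg _
  have e3 : ∫ p, |G p ^ 2 - 1| ∂ν ≤ ∫ p, (65 / 16 * G p ^ 2 - 63 / 8 * G p + 65 / 16) ∂ν := by
    refine integral_mono (hG2i.sub (integrable_const 1)).abs (by fun_prop) fun p => ?_
    have := abs_sq_sub_one_le (hG0 p)
    dsimp only
    linarith
  have e4 : ∫ p, (65 / 16 * G p ^ 2 - 63 / 8 * G p + 65 / 16) ∂ν =
      65 / 8 - 63 / 8 * ∫ p, G p ∂ν := by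
    rw [integral_add (by fun_prop) (by fun_prop), integral_sub (by fun_prop) (by fun_prop),
      integral_const_mul, integral_const_mul, h1]
    simp; ring
  have hB' : 1 + n * (∫ ω, √(f ω) ∂(ρ ⊗ₘ η) - 1) ≤ ∫ p, G p ∂ν := hB
  linarith

/-- Signs that are balanced, vanish at most once, and for which the signed sum of nonnegative
functions is no larger in `L²` than for orthogonal functions. -/
theorem exists_balanced_signs {X Ω : Type*} [DecidableEq X] [MeasurableSpace Ω] (μ : Measure Ω)
    [IsFiniteMeasure μ] (h : X → Ω → ℝ) (hm : ∀ x, Measurable (h x)) (h0 : ∀ x ω, 0 ≤ h x ω)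
    (C : ℝ) (hC : ∀ x ω, h x ω ≤ C) (k : ℕ) : ∀ s : Finset X, s.card = k →
    ∃ σ : X → ℝ, (∀ x, σ x = -1 ∨ σ x = 0 ∨ σ x = 1) ∧ ∑ x ∈ s, σ x = 0 ∧
      (k : ℝ) - 1 ≤ ∑ x ∈ s, σ x ^ 2 ∧
      ∫ ω, (∑ x ∈ s, σ x * h x ω) ^ 2 ∂μ ≤ ∑ x ∈ s, ∫ ω, h x ω ^ 2 ∂μ := by
  have hhi : ∀ x y, Integrable (fun ω => h x ω * h y ω) μ := fun x y =>
    integrable_of_bounds ((hm x).mul (hm y)) (C := C * C)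
      (fun ω => mul_nonneg (h0 x ω) (h0 y ω))
      fun ω => mul_le_mul (hC x ω) (hC y ω) (h0 y ω) ((h0 x ω).trans (hC x ω))
  induction k using Nat.strong_induction_on with
  | _ k ih =>
    intro s hs
    by_cases hk : k ≤ 1
    -- A single leftover element, present when the cardinality is odd, gets sign `0`; this is the
    -- loss of `1` in the bound on `∑ σ x ^ 2`.
    · refine ⟨fun _ => 0, fun _ => Or.inr (Or.inl rfl), by simp, ?_, ?_⟩
      · have : (k : ℝ) ≤ 1 := by exact_mod_cast hk
        simpa using this
      · simpa using Finset.sum_nonneg fun x _ => integral_nonneg fun ω => sq_nonneg (h x ω)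
    · obtain ⟨a, ha, b, hb, hab⟩ := Finset.one_lt_card.1 (by omega : 1 < s.card)
      set t := (s.erase a).erase b with ht
      have hat : a ∉ t := by simp [ht]
      have hbt : b ∉ insert a t := by simp [ht, hab.symm]
      have hst : s = insert b (insert a t) := by
        ext x
        by_cases hxa : x = a <;> by_cases hxb : x = b <;> simp_all
      have hbt' : b ∉ t := fun hh => hbt (Finset.mem_insert_of_mem hh)
      have htc : t.card = k - 2 := by
        rw [hst, Finset.card_insert_of_notMem hbt, Finset.card_insert_of_notMem hat] at hs
        omega
      obtain ⟨σ, hσ, hσ0, hσ2, hσi⟩ := ih (k - 2) (by omega) t htc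
      have hsum : ∀ (φ : ℝ → X → ℝ) (e : ℝ),
          ∑ x ∈ s, φ (if x = a then e else if x = b then -e else σ x) x =
            φ e a + φ (-e) b + ∑ x ∈ t, φ (σ x) x := by
        intro φ e
        rw [hst, Finset.sum_insert hbt, Finset.sum_insert hat]
        have : ∑ x ∈ t, φ (if x = a then e else if x = b then -e else σ x) x =
            ∑ x ∈ t, φ (σ x) x := by
          refine Finset.sum_congr rfl fun x hx => ?_
          rw [if_neg (fun hh : x = a => hat (hh ▸ hx)), if_neg (fun hh : x = b => hbt' (hh ▸ hx))]
        rw [this]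
        simp [hab.symm]
        ring
      set A : Ω → ℝ := fun ω => ∑ x ∈ t, σ x * h x ω with hA
      have hAi : ∀ y, Integrable (fun ω => A ω * h y ω) μ := fun y => by
        simp only [hA, Finset.sum_mul, mul_assoc]
        exact integrable_finsetSum _ fun x _ => (hhi x y).const_mul _
      have hA2 : Integrable (fun ω => A ω ^ 2) μ := by
        have : (fun ω => A ω ^ 2) = fun ω => ∑ x ∈ t, σ x * (A ω * h x ω) := by
          ext ω
          rw [sq]
          nth_rewrite 2 [hA]
          simp only [Finset.mul_sum]
          exact Finset.sum_congr rfl fun x _ => by ring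
        rw [this]
        exact integrable_finsetSum _ fun x _ => (hAi x).const_mul _
      set c : ℝ := ∫ ω, A ω * h a ω ∂μ - ∫ ω, A ω * h b ω ∂μ with hc
      -- The new pair `a`, `b` gets opposite signs `e`, `-e`, which preserves balance. The cross
      -- term with the earlier sum is `2 * e * c`, and `e` is chosen to make it nonpositive.
      obtain ⟨e, he, hec⟩ : ∃ e : ℝ, (e = 1 ∨ e = -1) ∧ e * c ≤ 0 := by
        rcases le_total c 0 with hc0 | hc0
        · exact ⟨1, Or.inl rfl, by linarith⟩
        · exact ⟨-1, Or.inr rfl, by linarith⟩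
      have he2 : e ^ 2 = 1 := by rcases he with rfl | rfl <;> norm_num
      refine ⟨fun x => if x = a then e else if x = b then -e else σ x, fun x => ?_, ?_, ?_, ?_⟩
      · dsimp only
        split_ifs
        · rcases he with rfl | rfl <;> simp
        · rcases he with rfl | rfl <;> simp
        · exact hσ x
      · rw [hsum (fun z _ => z), hσ0]
        ring
      · rw [hsum (fun z _ => z ^ 2)]
        rw [Nat.cast_sub (by omega)] at hσ2
        push_cast at hσ2
        nlinarith
      · have e1 : ∀ ω, (∑ x ∈ s, (if x = a then e else if x = b then -e else σ x) * h x ω) ^ 2 =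
            A ω ^ 2 + 2 * e * (A ω * h a ω) - 2 * e * (A ω * h b ω) + h a ω * h a ω +
              h b ω * h b ω - 2 * (h a ω * h b ω) := by
          intro ω
          rw [hsum (fun z x => z * h x ω)]
          have : ∑ x ∈ t, σ x * h x ω = A ω := rfl
          rw [this]
          linear_combination (h a ω - h b ω) ^ 2 * he2
        simp only [e1]
        have i1 := hAi a
        have i2 := hAi b
        have i3 := hhi a a
        have i4 := hhi b b
        have i5 := hhi a b
        rw [integral_sub (by fun_prop) (by fun_prop), integral_add (by fun_prop) (by fun_prop),
          integral_add (by fun_prop) (by fun_prop), integral_sub (by fun_prop) (by fun_prop),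
          integral_add (by fun_prop) (by fun_prop), integral_const_mul, integral_const_mul,
          integral_const_mul, hst, Finset.sum_insert hbt, Finset.sum_insert hat]
        -- Nonnegativity of the functions lets the mixed term of `(h a - h b) ^ 2` be dropped, as if
        -- they were orthogonal.
        have h6 : 0 ≤ ∫ ω, h a ω * h b ω ∂μ :=
          integral_nonneg fun ω => mul_nonneg (h0 a ω) (h0 b ω)
        simp only [sq] at hσi ⊢
        simp only [hA] at hσi hc ⊢
        nlinarith

end Affinity

/-! ### An input perturbation that the transcript barely reveals -/

section Perturbation

variable {Γ M : Type*} [MeasurableSpace Γ] [MeasurableSpace M]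

theorem real_withDensity_ofReal {Ω : Type*} [MeasurableSpace Ω] (μ : Measure Ω) {r : Ω → ℝ}
    (hr : Measurable r) (h0 : ∀ ω, 0 ≤ r ω) {S : Set Ω} (hS : MeasurableSet S) :
    (μ.withDensity fun ω => ENNReal.ofReal (r ω)).real S = ∫ ω in S, r ω ∂μ := by
  rw [measureReal_def, withDensity_apply _ hS,
    integral_eq_lintegral_of_nonneg_ae (ae_of_all _ h0) hr.aestronglyMeasurable]

/-- The analyzer enters only as a `[0, 1]`-valued test function against the transcript density, so
`L¹` closeness of densities controls every output event. -/
theorem real_output_eq_integral {n : ℕ} {X : Type*} (P : Protocol n X Γ M) (η : Kernel Γ M)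
    [IsMarkovKernel η] (r : X → Γ × M → ℝ) (hr : ∀ x, Measurable (r x)) (h0 : ∀ x ω, 0 ≤ r x ω)
    (h : ∀ x, P.view x = (P.coin ⊗ₘ η).withDensity fun ω => ENNReal.ofReal (r x ω))
    (x : Fin n → X) {A : Set ℝ} (hA : MeasurableSet A) :
    (P.output x).real A = ∫ t, (P.analyzer t).real A * ∏ i, r (x i) (t.1, t.2 i)
      ∂(P.coin ⊗ₘ piKernel fun _ : Fin n => η) := by
  have hφ : Measurable fun t => (P.analyzer t).real A :=
    (P.analyzer.measurable_coe hA).ennreal_toReal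
  have hprod : Measurable fun t : Γ × (Fin n → M) => ∏ i, r (x i) (t.1, t.2 i) :=
    Finset.measurable_prod _ fun i _ => (hr _).comp (by fun_prop)
  have ht : P.transcript x = (P.coin ⊗ₘ piKernel fun _ : Fin n => η).withDensity
      fun t => ∏ i, ENNReal.ofReal (r (x i) (t.1, t.2 i)) :=
    compProd_piKernel_eq_withDensity P.coin (fun i => P.randomizer (x i)) η
      (fun i ω => ENNReal.ofReal (r (x i) ω)) (fun i => (hr _).ennreal_ofReal) fun i => h (x i)
  have hnn : ∀ t : Γ × (Fin n → M), 0 ≤ ∏ i, r (x i) (t.1, t.2 i) :=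
    fun t => Finset.prod_nonneg fun i _ => h0 _ _
  rw [measureReal_def, Protocol.output, Measure.bind_apply hA (Kernel.aemeasurable _), ht,
    lintegral_withDensity_eq_lintegral_mul _ ?_ (P.analyzer.measurable_coe hA),
    integral_eq_lintegral_of_nonneg_ae (ae_of_all _ fun t => mul_nonneg measureReal_nonneg (hnn t))
      (hφ.mul hprod).aestronglyMeasurable]
  · congr 1
    refine lintegral_congr fun t => ?_
    rw [ENNReal.ofReal_mul measureReal_nonneg, ENNReal.ofReal_prod_of_nonneg fun i _ => h0 _ _,
      ofReal_measureReal, Pi.mul_apply, mul_comm]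
  · exact Finset.measurable_prod _ fun i _ =>
      ((hr _).ennreal_ofReal).comp (by fun_prop : Measurable fun t : Γ × (Fin n → M) =>
        (t.1, t.2 i))

/-- The output law on inputs drawn independently from `p`. -/
theorem sum_real_output_eq_integral {n : ℕ} {X : Type*} [Fintype X] (P : Protocol n X Γ M)
    (η : Kernel Γ M) [IsMarkovKernel η] (r : X → Γ × M → ℝ) (hr : ∀ x, Measurable (r x))
    (h0 : ∀ x ω, 0 ≤ r x ω) {C : ℝ} (hC : ∀ x ω, r x ω ≤ C)
    (h : ∀ x, P.view x = (P.coin ⊗ₘ η).withDensity fun ω => ENNReal.ofReal (r x ω))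
    (p : X → ℝ) {A : Set ℝ} (hA : MeasurableSet A) :
    ∑ x : Fin n → X, (∏ i, p (x i)) * (P.output x).real A =
      ∫ t, (P.analyzer t).real A * ∏ i, ∑ y, p y * r y (t.1, t.2 i)
        ∂(P.coin ⊗ₘ piKernel fun _ : Fin n => η) := by
  classical
  have hφ : Measurable fun t => (P.analyzer t).real A :=
    (P.analyzer.measurable_coe hA).ennreal_toReal
  have hprod : ∀ x : Fin n → X,
      Measurable fun t : Γ × (Fin n → M) => ∏ i, r (x i) (t.1, t.2 i) :=
    fun x => Finset.measurable_prod _ fun i _ => (hr _).comp (by fun_prop)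
  have e : ∀ t : Γ × (Fin n → M), (P.analyzer t).real A * ∏ i, ∑ y, p y * r y (t.1, t.2 i) =
      ∑ x : Fin n → X, (∏ i, p (x i)) *
        ((P.analyzer t).real A * ∏ i, r (x i) (t.1, t.2 i)) := by
    intro t
    rw [Finset.prod_univ_sum, Fintype.piFinset_univ, Finset.mul_sum]
    refine Finset.sum_congr rfl fun x _ => ?_
    rw [Finset.prod_mul_distrib]
    ring
  simp only [e]
  rw [integral_finsetSum]
  · refine Finset.sum_congr rfl fun x _ => ?_
    rw [integral_const_mul, real_output_eq_integral P η r hr h0 h x hA]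
  · intro x _
    refine Integrable.const_mul (integrable_of_bounds (hφ.mul (hprod x)) (C := 1 * C ^ n)
      (fun t => mul_nonneg measureReal_nonneg (Finset.prod_nonneg fun i _ => h0 _ _))
      fun t => ?_) _
    refine mul_le_mul measureReal_le_one ?_ (Finset.prod_nonneg fun i _ => h0 _ _) zero_le_one
    calc ∏ i, r (x i) (t.1, t.2 i) ≤ ∏ _i : Fin n, C :=
          Finset.prod_le_prod (fun i _ => h0 _ _) fun i _ => hC _ _
      _ = C ^ n := by simp

/-- Under approximate differential privacy, the density of a message exceeds `e ^ ε` only by `δ` in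
total. -/
theorem integral_sub_min_le {n : ℕ} {X : Type*} [Fintype X] [Nonempty X] (P : Protocol n X Γ M)
    {ε δ : ℝ} (hP : P.IsLocallyDP ε δ) (r : X → Γ × M → ℝ) (hr : ∀ x, Measurable (r x))
    (h0 : ∀ x ω, 0 ≤ r x ω) {C : ℝ} (hC : ∀ x ω, r x ω ≤ C)
    (h : ∀ x, P.view x =
      (P.coin ⊗ₘ avgKernel P.randomizer).withDensity fun ω => ENNReal.ofReal (r x ω)) (x : X) :
    ∫ ω, (r x ω - min (r x ω) (Real.exp ε)) ∂(P.coin ⊗ₘ avgKernel P.randomizer) ≤ δ := by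
  set μ := P.coin ⊗ₘ avgKernel P.randomizer with hμ
  set S : Set (Γ × M) := {ω | Real.exp ε < r x ω} with hS
  have hSm : MeasurableSet S := measurableSet_lt measurable_const (hr x)
  have hri : Integrable (r x) μ := integrable_of_bounds (hr x) (h0 x) (hC x)
  have hpair : ∀ y, (P.view x).real S ≤ Real.exp ε * (P.view y).real S + δ := fun y =>
    hP (fun _ => x) (fun _ => y) ⟨1, 0, fun j hj => absurd (Subsingleton.elim j 0) hj⟩ S hSm
  have hcard : (0 : ℝ) < Fintype.card X := by exact_mod_cast Fintype.card_pos
  have hfin : ∀ y, IsProbabilityMeasure (P.coin ⊗ₘ P.randomizer y) := fun y => inferInstance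
  have havg : Fintype.card X * μ.real S = ∑ y, (P.view y).real S := by
    rw [hμ, compProd_avgKernel, measureReal_def, Measure.smul_apply, Measure.finsetSum_apply,
      smul_eq_mul, ENNReal.toReal_mul, ENNReal.toReal_sum fun y _ => measure_ne_top _ _]
    simp only [ENNReal.toReal_inv, ENNReal.toReal_natCast]
    rw [mul_inv_cancel_left₀ hcard.ne']
    rfl
  -- Averaging the privacy inequality over the second input replaces it by the mixture, against
  -- which the densities are taken.
  have hx : (P.view x).real S ≤ Real.exp ε * μ.real S + δ := by
    have h1 := Finset.sum_le_sum fun y (_ : y ∈ Finset.univ) => hpair y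
    rw [Finset.sum_add_distrib, ← Finset.mul_sum, ← havg] at h1
    simp only [Finset.sum_const, Finset.card_univ, nsmul_eq_mul] at h1
    refine le_of_mul_le_mul_left ?_ hcard
    linarith
  rw [h x, real_withDensity_ofReal μ (hr x) (h0 x) hSm] at hx
  have e : ∀ ω, r x ω - min (r x ω) (Real.exp ε) = S.indicator (fun ω => r x ω - Real.exp ε) ω := by
    intro ω
    by_cases hω : ω ∈ S
    · rw [Set.indicator_of_mem hω, min_eq_right (le_of_lt hω)]
    · rw [Set.indicator_of_notMem hω, min_eq_left (not_lt.1 hω), sub_self]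
  simp only [e]
  rw [integral_indicator hSm, integral_sub hri.integrableOn (integrable_const _)]
  simp only [integral_const, smul_eq_mul, measureReal_restrict_apply MeasurableSet.univ,
    Set.univ_inter]
  linarith

/-- For a locally private protocol there is a perturbation of the uniform input distribution, of
relative size `e ^ (-ε / 2) / 8` at (almost) every input, that barely changes the law of the
output. -/
theorem exists_perturbation {n : ℕ} (hn : 0 < n) (P : Protocol n (Fin n) Γ M) {ε δ : ℝ}
    (hε : 0 ≤ ε) (hδ : n * δ ≤ 1 / 16) (hP : P.IsLocallyDP ε δ) :
    ∃ σ : Fin n → ℝ, (∀ x, σ x = -1 ∨ σ x = 0 ∨ σ x = 1) ∧ ∑ x, σ x = 0 ∧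
      (n : ℝ) - 1 ≤ ∑ x, σ x ^ 2 ∧ ∀ A : Set ℝ, MeasurableSet A →
      |∑ x : Fin n → Fin n, (∏ i, (1 + Real.exp (-ε / 2) / 8 * σ (x i)) / n) *
          (P.output x).real A -
        ∑ x : Fin n → Fin n, (∏ _i : Fin n, 1 / (n : ℝ)) * (P.output x).real A| ≤ 1 / 2 := by
  have : Nonempty (Fin n) := ⟨⟨0, hn⟩⟩
  have hn0 : (0 : ℝ) < n := by exact_mod_cast hn
  set η := avgKernel P.randomizer with hη
  set μ := P.coin ⊗ₘ η with hμ
  have hvp : ∀ x, IsProbabilityMeasure (P.view x) := fun x => by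
    unfold Protocol.view; infer_instance
  obtain ⟨r, hr, h0, hsum, h⟩ := exists_density_of_mixture P.view μ
    (compProd_avgKernel P.coin P.randomizer)
  rw [Fintype.card_fin] at hsum
  have hC : ∀ x ω, r x ω ≤ n := fun x ω => by
    rw [← hsum ω]
    exact Finset.single_le_sum (fun y _ => h0 y ω) (Finset.mem_univ x)
  have hri : ∀ x, Integrable (r x) μ := fun x => integrable_of_bounds (hr x) (h0 x) (hC x)
  have hr1 : ∀ x, ∫ ω, r x ω ∂μ = 1 := fun x => by
    have h1 := real_withDensity_ofReal μ (hr x) (h0 x) MeasurableSet.univ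
    rw [← h x, probReal_univ, setIntegral_univ] at h1
    exact h1.symm
  set E := Real.exp ε with hE
  have hE0 : 0 < E := Real.exp_pos ε
  set g : Fin n → Γ × M → ℝ := fun x ω => min (r x ω) E with hg
  have hgm : ∀ x, Measurable (g x) := fun x => (hr x).min measurable_const
  have hg0 : ∀ x ω, 0 ≤ g x ω := fun x ω => le_min (h0 x ω) hE0.le
  have hgE : ∀ x ω, g x ω ≤ E := fun x ω => min_le_right _ _
  have hgr : ∀ x ω, g x ω ≤ r x ω := fun x ω => min_le_left _ _
  obtain ⟨σ, hσ, hσ0, hσ2, hσi⟩ := exists_balanced_signs μ g hgm hg0 E hgE n Finset.univ (by simp)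
  refine ⟨σ, hσ, hσ0, hσ2, fun A hA => ?_⟩
  set τ := Real.exp (-ε / 2) / 8 with hτ
  have hτ0 : 0 < τ := by positivity
  have hτ1 : τ ≤ 1 / 8 := by
    have : Real.exp (-ε / 2) ≤ 1 := Real.exp_le_one_iff.2 (by linarith)
    rw [hτ]; linarith
  have hτE : τ ^ 2 * E = 1 / 64 := by
    rw [hτ, hE, div_pow, ← Real.exp_nat_mul, div_mul_eq_mul_div, ← Real.exp_add]
    push_cast
    rw [show 2 * (-ε / 2) + ε = 0 by ring, Real.exp_zero]
    norm_num
  have hσabs : ∀ x, |σ x| ≤ 1 := fun x => by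
    rcases hσ x with h1 | h1 | h1 <;> rw [h1] <;> norm_num
  set p : Fin n → ℝ := fun x => (1 + τ * σ x) / n with hp
  have hp0 : ∀ x, 0 ≤ p x := fun x => by
    have := neg_le_of_abs_le (hσabs x)
    exact div_nonneg (by nlinarith) hn0.le
  have hp1 : ∑ x, p x = 1 := by
    simp only [hp, ← Finset.sum_div, Finset.sum_add_distrib, ← Finset.mul_sum, hσ0]
    simp [hn0.ne']
  set f : Γ × M → ℝ := fun ω => ∑ x, p x * r x ω with hf
  have hfm : Measurable f := Finset.measurable_sum _ fun x _ => (hr x).const_mul _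
  have hf0 : ∀ ω, 0 ≤ f ω := fun ω => Finset.sum_nonneg fun x _ => mul_nonneg (hp0 x) (h0 x ω)
  have hfC : ∀ ω, f ω ≤ n := fun ω => by
    calc f ω ≤ ∑ x, p x * n :=
          Finset.sum_le_sum fun x _ => mul_le_mul_of_nonneg_left (hC x ω) (hp0 x)
      _ = n := by rw [← Finset.sum_mul, hp1, one_mul]
  set ν := P.coin ⊗ₘ piKernel fun _ : Fin n => η with hν
  have hmix := fun (q : Fin n → ℝ) {B : Set ℝ} (hB : MeasurableSet B) =>
    sum_real_output_eq_integral P η r hr h0 hC h q hB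
  have hop : ∀ x, IsProbabilityMeasure (P.output x) := fun x => by
    unfold Protocol.output Protocol.transcript; infer_instance
  have hF1 : ∫ t, ∏ i, f (t.1, t.2 i) ∂ν = 1 := by
    have h1 := hmix p MeasurableSet.univ
    simp only [probReal_univ, one_mul, mul_one] at h1
    rw [← Fintype.sum_pow, hp1, one_pow] at h1
    exact h1.symm
  -- The density of one message is `1 + u + w`: `u` comes from the truncated densities and is small
  -- in `L²`; `w` comes from the excess over `e ^ ε` and is small in `L¹`.
  set u : Γ × M → ℝ := fun ω => τ / n * ∑ x, σ x * g x ω with hu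
  set w : Γ × M → ℝ := fun ω => τ / n * ∑ x, σ x * (r x ω - g x ω) with hw
  have hfuw : ∀ ω, f ω = 1 + u ω + w ω := fun ω => by
    have h1 : f ω = (∑ x, r x ω) / n + τ / n * ∑ x, σ x * r x ω := by
      simp only [hf, hp, Finset.mul_sum, Finset.sum_div, ← Finset.sum_add_distrib]
      exact Finset.sum_congr rfl fun x _ => by ring
    rw [h1, hsum, div_self hn0.ne', add_assoc, hu, hw, ← mul_add, ← Finset.sum_add_distrib]
    congr 2
    exact Finset.sum_congr rfl fun x _ => by ring
  have hum : Measurable u :=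
    (Finset.measurable_sum _ fun x _ => (hgm x).const_mul _).const_mul _
  have hgi : ∀ x, Integrable (g x) μ := fun x => integrable_of_bounds (hgm x) (hg0 x) (hgE x)
  have hui : Integrable u μ :=
    (integrable_finsetSum _ fun x _ => (hgi x).const_mul _).const_mul _
  have hwi : Integrable w μ :=
    (integrable_finsetSum _ fun x _ => ((hri x).sub (hgi x)).const_mul _).const_mul _
  have huw : ∫ ω, (u ω + w ω) ∂μ = 0 := by
    have h1 : ∀ ω, u ω + w ω = τ / n * ∑ x, σ x * r x ω := fun ω => by
      rw [hu, hw, ← mul_add, ← Finset.sum_add_distrib]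
      congr 1
      exact Finset.sum_congr rfl fun x _ => by ring
    simp only [h1]
    rw [integral_const_mul, integral_finsetSum _ fun x _ => (hri x).const_mul _]
    simp only [integral_const_mul, hr1, mul_one, hσ0, mul_zero]
  have hu2 : ∫ ω, u ω ^ 2 ∂μ ≤ 1 / (64 * n) := by
    have h1 : ∫ ω, u ω ^ 2 ∂μ = (τ / n) ^ 2 * ∫ ω, (∑ x, σ x * g x ω) ^ 2 ∂μ := by
      rw [← integral_const_mul]
      exact integral_congr_ae (ae_of_all _ fun ω => by simp only [hu, mul_pow])
    -- One factor of `g x ^ 2` is bounded by `E`, the other by `r x`, which has integral `1`.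
    -- Bounding both by `E` would lose a factor `e ^ ε`.
    have h2 : ∑ x, ∫ ω, g x ω ^ 2 ∂μ ≤ n * E := by
      have h3 : ∀ x, ∫ ω, g x ω ^ 2 ∂μ ≤ E := fun x => by
        calc ∫ ω, g x ω ^ 2 ∂μ ≤ ∫ ω, E * r x ω ∂μ := by
              refine integral_mono_of_nonneg (ae_of_all _ fun ω => sq_nonneg _)
                ((hri x).const_mul _) (ae_of_all _ fun ω => ?_)
              change g x ω ^ 2 ≤ E * r x ω
              rw [sq]
              exact mul_le_mul (hgE x ω) (hgr x ω) (hg0 x ω) hE0.le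
          _ = E := by rw [integral_const_mul, hr1, mul_one]
      calc ∑ x, ∫ ω, g x ω ^ 2 ∂μ ≤ ∑ _x : Fin n, E := Finset.sum_le_sum fun x _ => h3 x
        _ = n * E := by simp
    calc ∫ ω, u ω ^ 2 ∂μ ≤ (τ / n) ^ 2 * (n * E) := by
          rw [h1]
          exact mul_le_mul_of_nonneg_left (hσi.trans h2) (sq_nonneg _)
      _ = τ ^ 2 * E / n := by field_simp
      _ = 1 / (64 * n) := by rw [hτE]; field_simp
  have hw1 : ∫ ω, |w ω| ∂μ ≤ τ * δ := by
    have h1 : ∀ ω, |w ω| ≤ τ / n * ∑ x, (r x ω - g x ω) := fun ω => by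
      rw [hw, abs_mul, abs_of_pos (by positivity : 0 < τ / n)]
      refine mul_le_mul_of_nonneg_left ((Finset.abs_sum_le_sum_abs _ _).trans
        (Finset.sum_le_sum fun x _ => ?_)) (by positivity)
      have h2 : 0 ≤ r x ω - g x ω := sub_nonneg.2 (hgr x ω)
      rw [abs_mul, abs_of_nonneg h2]
      exact mul_le_of_le_one_left h2 (hσabs x)
    have hrg : ∀ x, Integrable (fun ω => r x ω - g x ω) μ := fun x => (hri x).sub (hgi x)
    have hi : Integrable (fun ω => τ / n * ∑ x, (r x ω - g x ω)) μ :=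
      (integrable_finsetSum _ fun x _ => hrg x).const_mul _
    calc ∫ ω, |w ω| ∂μ ≤ ∫ ω, τ / n * ∑ x, (r x ω - g x ω) ∂μ :=
          integral_mono hwi.abs hi h1
      _ = τ / n * ∑ x, ∫ ω, (r x ω - g x ω) ∂μ := by
          rw [integral_const_mul, integral_finsetSum _ fun x _ => hrg x]
      _ ≤ τ / n * ∑ _x : Fin n, δ :=
          mul_le_mul_of_nonneg_left (Finset.sum_le_sum fun x _ =>
            integral_sub_min_le P hP r hr h0 hC h x) (by positivity)
      _ = τ * δ := by simp; field_simp
  have hsqrt : 1 - 1 / (64 * n) - 2 * (τ * δ) ≤ ∫ ω, √(f ω) ∂μ := by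
    have hsi : Integrable (fun ω => √(f ω)) μ := integrable_of_bounds (by fun_prop) (C := √n)
      (fun ω => Real.sqrt_nonneg _) fun ω => Real.sqrt_le_sqrt (hfC ω)
    have hu2i : Integrable (fun ω => u ω ^ 2) μ := by
      refine Integrable.of_bound (hum.pow_const 2).aestronglyMeasurable ((τ / n * (n * E)) ^ 2)
        (ae_of_all _ fun ω => ?_)
      rw [Real.norm_of_nonneg (sq_nonneg _), ← sq_abs (u ω)]
      refine pow_le_pow_left₀ (abs_nonneg _) ?_ 2
      rw [hu, abs_mul, abs_of_pos (by positivity : 0 < τ / n)]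
      refine mul_le_mul_of_nonneg_left ((Finset.abs_sum_le_sum_abs _ _).trans ?_) (by positivity)
      calc ∑ x, |σ x * g x ω| ≤ ∑ _x : Fin n, E := Finset.sum_le_sum fun x _ => by
            rw [abs_mul, abs_of_nonneg (hg0 x ω)]
            exact (mul_le_of_le_one_left (hg0 x ω) (hσabs x)).trans (hgE x ω)
        _ = n * E := by simp
    have huwi : Integrable (fun ω => u ω + w ω) μ := hui.add hwi
    have hwa : Integrable (fun ω => |w ω|) μ := hwi.abs
    have h1 : ∫ ω, (1 + (u ω + w ω) / 2 - u ω ^ 2 - 2 * |w ω|) ∂μ ≤ ∫ ω, √(f ω) ∂μ := by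
      refine integral_mono (by fun_prop) hsi fun ω => ?_
      have h2 := hf0 ω
      dsimp only
      rw [hfuw] at h2 ⊢
      exact one_add_half_sub_le_sqrt h2
    rw [integral_sub (by fun_prop) (by fun_prop), integral_sub (by fun_prop) (by fun_prop),
      integral_add (by fun_prop) (by fun_prop), integral_div, integral_const_mul, huw] at h1
    simp only [integral_const, probReal_univ, smul_eq_mul] at h1
    linarith
  -- The budget is `1 / 4` from AM-GM, `1 / 8` from `u`, and `16 * τ * (n * δ) ≤ 1 / 8` from `w`.
  have hTV : ∫ t, |∏ i, f (t.1, t.2 i) - 1| ∂ν ≤ 1 / 2 := by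
    refine (integral_abs_prod_sub_one_le P.coin η hfm hf0 hfC hF1).trans ?_
    have h1 : 8 * (n : ℝ) * (1 - ∫ ω, √(f ω) ∂μ) ≤ 8 * n * (1 / (64 * n) + 2 * (τ * δ)) :=
      mul_le_mul_of_nonneg_left (by linarith) (by positivity)
    have h2 : 8 * (n : ℝ) * (1 / (64 * n) + 2 * (τ * δ)) = 1 / 8 + 16 * τ * (n * δ) := by
      field_simp; ring
    have h3 : τ * (n * δ) ≤ 1 / 8 * (1 / 16) :=
      (mul_le_mul_of_nonneg_left hδ hτ0.le).trans (by linarith)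
    linarith
  have hunif : ∀ ω, ∑ y, 1 / (n : ℝ) * r y ω = 1 := fun ω => by
    rw [← Finset.mul_sum, hsum, one_div_mul_cancel hn0.ne']
  rw [hmix p hA, hmix (fun _ => 1 / (n : ℝ)) hA]
  simp only [hunif, Finset.prod_const_one, mul_one]
  have hφm : Measurable fun t => (P.analyzer t).real A :=
    (P.analyzer.measurable_coe hA).ennreal_toReal
  have hφi : Integrable (fun t => (P.analyzer t).real A) ν :=
    integrable_of_bounds hφm (fun t => measureReal_nonneg) fun t => measureReal_le_one
  have hFm : Measurable fun t : Γ × (Fin n → M) => ∏ i, f (t.1, t.2 i) :=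
    Finset.measurable_prod _ fun i _ => hfm.comp (by fun_prop)
  have hF0 : ∀ t : Γ × (Fin n → M), 0 ≤ ∏ i, f (t.1, t.2 i) :=
    fun t => Finset.prod_nonneg fun i _ => hf0 _
  have hFC : ∀ t : Γ × (Fin n → M), ∏ i, f (t.1, t.2 i) ≤ (n : ℝ) ^ n := fun t => by
    calc ∏ i, f (t.1, t.2 i) ≤ ∏ _i : Fin n, (n : ℝ) :=
          Finset.prod_le_prod (fun i _ => hf0 _) fun i _ => hfC _
      _ = (n : ℝ) ^ n := by simp
  have hFi : Integrable (fun t : Γ × (Fin n → M) => ∏ i, f (t.1, t.2 i)) ν :=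
    integrable_of_bounds hFm hF0 hFC
  have hφFi : Integrable (fun t : Γ × (Fin n → M) =>
      (P.analyzer t).real A * ∏ i, f (t.1, t.2 i)) ν :=
    integrable_of_bounds (hφm.mul hFm) (C := 1 * (n : ℝ) ^ n)
      (fun t => mul_nonneg measureReal_nonneg (hF0 t))
      fun t => mul_le_mul measureReal_le_one (hFC t) (hF0 t) zero_le_one
  rw [← integral_sub hφFi hφi]
  refine (abs_integral_le_integral_abs).trans (le_trans ?_ hTV)
  refine integral_mono (hφFi.sub hφi).abs (hFi.sub (integrable_const 1)).abs fun t => ?_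
  dsimp only
  rw [← mul_sub_one, abs_mul, abs_of_nonneg measureReal_nonneg]
  exact mul_le_of_le_one_left (abs_nonneg _) measureReal_le_one

end Perturbation

/-! ### Mean, concentration and sensitivity of the distinct count -/

section DistinctCount

theorem countDistinct_eq (n D : ℕ) (x : Fin n → Fin D) :
    countDistinct n D x = D - ∑ y, ∏ i, if x i = y then (0 : ℝ) else 1 := by
  have h : ∀ y, (∏ i, if x i = y then (0 : ℝ) else 1) =
      1 - if y ∈ Finset.univ.image x then 1 else 0 := by
    intro y
    by_cases hy : y ∈ Finset.univ.image x
    · obtain ⟨i, -, hi⟩ := Finset.mem_image.1 hy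
      rw [if_pos hy, sub_self]
      exact Finset.prod_eq_zero (Finset.mem_univ i) (if_pos hi)
    · rw [if_neg hy, sub_zero]
      refine Finset.prod_eq_one fun i _ => if_neg fun hi => hy ?_
      exact Finset.mem_image.2 ⟨i, Finset.mem_univ i, hi⟩
  simp only [h, Finset.sum_sub_distrib]
  simp [countDistinct]

variable {n D : ℕ} (p : Fin D → ℝ)

theorem sum_prod_mul_prod (g : Fin D → ℝ) :
    ∑ x : Fin n → Fin D, (∏ i, p (x i)) * ∏ i, g (x i) = (∑ y, p y * g y) ^ n := by
  simp only [← Finset.prod_mul_distrib]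
  exact (Fintype.sum_pow (fun y => p y * g y) n).symm

theorem sum_mul_missing (hp1 : ∑ y, p y = 1) :
    ∑ x : Fin n → Fin D, (∏ i, p (x i)) * ∑ y, ∏ i, (if x i = y then (0 : ℝ) else 1) =
      ∑ y, (1 - p y) ^ n := by
  simp only [Finset.mul_sum]
  rw [Finset.sum_comm]
  refine Finset.sum_congr rfl fun y _ => ?_
  rw [sum_prod_mul_prod p fun z => if z = y then 0 else 1]
  simp only [mul_ite, mul_zero, mul_one]
  rw [← hp1, ← Finset.sum_erase_eq_sub (Finset.mem_univ y),
    ← Finset.add_sum_erase _ _ (Finset.mem_univ y), if_pos rfl, zero_add]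
  exact congrArg (· ^ n) (Finset.sum_congr rfl fun z hz => if_neg (Finset.ne_of_mem_erase hz))

/-- Two distinct elements are negatively correlated in being missed, because `1 - p y - p z ≤ (1 - p
y) * (1 - p z)`. Only the diagonal adds to the squared mean, at most `1` per element. -/
theorem sum_mul_missing_sq_le (hp0 : ∀ y, 0 ≤ p y) (hp1 : ∑ y, p y = 1) :
    ∑ x : Fin n → Fin D,
        (∏ i, p (x i)) * (∑ y, ∏ i, (if x i = y then (0 : ℝ) else 1)) ^ 2 ≤
      (∑ y, (1 - p y) ^ n) ^ 2 + D := by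
  have hple : ∀ y, p y ≤ 1 := fun y => by
    rw [← hp1]
    exact Finset.single_le_sum (fun z _ => hp0 z) (Finset.mem_univ y)
  have hcell : ∀ y z : Fin D,
      (∑ w, p w * ((if w = y then 0 else 1) * if w = z then 0 else 1)) ^ n ≤
        (1 - p y) ^ n * (1 - p z) ^ n + if y = z then 1 else 0 := by
    intro y z
    have hnn : 0 ≤ ∑ w, p w * ((if w = y then (0 : ℝ) else 1) * if w = z then 0 else 1) :=
      Finset.sum_nonneg fun w _ => mul_nonneg (hp0 w) (by split_ifs <;> norm_num)
    have hle : ∑ w, p w * ((if w = y then (0 : ℝ) else 1) * if w = z then 0 else 1) ≤ 1 := by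
      refine (Finset.sum_le_sum fun w _ => mul_le_of_le_one_right (hp0 w) ?_).trans hp1.le
      split_ifs <;> norm_num
    have hnn2 : 0 ≤ (1 - p y) ^ n * (1 - p z) ^ n :=
      mul_nonneg (pow_nonneg (sub_nonneg.2 (hple y)) n) (pow_nonneg (sub_nonneg.2 (hple z)) n)
    by_cases hyz : y = z
    · rw [if_pos hyz]
      have := pow_le_one₀ (n := n) hnn hle
      linarith
    · rw [if_neg hyz, add_zero, ← mul_pow]
      refine pow_le_pow_left₀ hnn ?_ n
      have e : ∀ w, p w * ((if w = y then (0 : ℝ) else 1) * if w = z then 0 else 1) =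
          p w - (if w = y then p w else 0) - if w = z then p w else 0 := by
        intro w
        by_cases h1 : w = y
        · have h2 : w ≠ z := fun h2 => hyz (h1.symm.trans h2)
          simp [h1, hyz]
        · by_cases h2 : w = z <;> simp [h1, h2]
          exact fun h3 => absurd h3.symm hyz
      simp only [e, Finset.sum_sub_distrib, hp1]
      simp only [Finset.sum_ite_eq', Finset.mem_univ, if_true]
      nlinarith [mul_nonneg (hp0 y) (hp0 z)]
  have hexp : ∀ x : Fin n → Fin D,
      (∏ i, p (x i)) * (∑ y, ∏ i, (if x i = y then (0 : ℝ) else 1)) ^ 2 =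
      ∑ y, ∑ z, (∏ i, p (x i)) *
        ∏ i, ((if x i = y then 0 else 1) * if x i = z then 0 else 1) := by
    intro x
    rw [sq, Finset.sum_mul_sum]
    simp only [Finset.mul_sum, Finset.prod_mul_distrib]
  simp only [hexp]
  rw [Finset.sum_comm]
  calc ∑ y, ∑ x : Fin n → Fin D, ∑ z, (∏ i, p (x i)) *
        ∏ i, ((if x i = y then (0 : ℝ) else 1) * if x i = z then 0 else 1)
      = ∑ y, ∑ z, (∑ w, p w * ((if w = y then 0 else 1) * if w = z then 0 else 1)) ^ n := by
        refine Finset.sum_congr rfl fun y _ => ?_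
        rw [Finset.sum_comm]
        exact Finset.sum_congr rfl fun z _ =>
          sum_prod_mul_prod p fun w => (if w = y then 0 else 1) * if w = z then 0 else 1
    _ ≤ ∑ y, ∑ z, ((1 - p y) ^ n * (1 - p z) ^ n + if y = z then 1 else 0) :=
        Finset.sum_le_sum fun y _ => Finset.sum_le_sum fun z _ => hcell y z
    _ = (∑ y, (1 - p y) ^ n) ^ 2 + D := by
        simp [Finset.sum_add_distrib, sq, Finset.sum_mul_sum]

/-- Chebyshev's inequality for the number of distinct elements among independent samples. -/
theorem sum_deviation_le (hp0 : ∀ y, 0 ≤ p y) (hp1 : ∑ y, p y = 1) {t : ℝ} (ht : 0 < t) :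
    ∑ x : Fin n → Fin D, (∏ i, p (x i)) *
        (if t ≤ |countDistinct n D x - (D - ∑ y, (1 - p y) ^ n)| then 1 else 0) ≤ D / t ^ 2 := by
  set m := ∑ y, (1 - p y) ^ n with hm
  set Z : (Fin n → Fin D) → ℝ := fun x => ∑ y, ∏ i, (if x i = y then (0 : ℝ) else 1) with hZ
  have hW : ∀ x : Fin n → Fin D, 0 ≤ ∏ i, p (x i) := fun x => Finset.prod_nonneg fun i _ => hp0 _
  have hW1 : ∑ x : Fin n → Fin D, ∏ i, p (x i) = 1 := by rw [← Fintype.sum_pow, hp1, one_pow]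
  have h1 : ∑ x : Fin n → Fin D, (∏ i, p (x i)) * Z x = m := sum_mul_missing p hp1
  have h2 : ∑ x : Fin n → Fin D, (∏ i, p (x i)) * Z x ^ 2 ≤ m ^ 2 + D :=
    sum_mul_missing_sq_le p hp0 hp1
  have hvar : ∑ x : Fin n → Fin D, (∏ i, p (x i)) * (Z x - m) ^ 2 ≤ D := by
    have e : ∀ x : Fin n → Fin D, (∏ i, p (x i)) * (Z x - m) ^ 2 =
        (∏ i, p (x i)) * Z x ^ 2 - 2 * m * ((∏ i, p (x i)) * Z x) +
          m ^ 2 * ∏ i, p (x i) := fun x => by ring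
    simp only [e, Finset.sum_add_distrib, Finset.sum_sub_distrib, ← Finset.mul_sum, h1, hW1]
    linarith
  rw [le_div_iff₀ (by positivity), Finset.sum_mul]
  refine le_trans (Finset.sum_le_sum fun x _ => ?_) hvar
  rw [mul_assoc]
  refine mul_le_mul_of_nonneg_left ?_ (hW x)
  split_ifs with h
  · rw [countDistinct_eq, show (D : ℝ) - Z x - (D - m) = -(Z x - m) by ring, abs_neg] at h
    rw [one_mul, ← sq_abs (Z x - m)]
    exact pow_le_pow_left₀ ht.le h 2
  · rw [zero_mul]
    exact sq_nonneg _

/-- These are leading terms of binomial expansions. Sum and difference of the powers feed each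
other's recursion, hence the joint induction, which also covers `a < b`. -/
theorem add_pow_add_sub_pow_ge {a b : ℝ} (ha : 0 ≤ a) (hb : 0 ≤ b) (k : ℕ) :
    2 * a ^ (k + 1) ≤ (a + b) ^ (k + 1) + (a - b) ^ (k + 1) ∧
    2 * (k + 1) * a ^ k * b ≤ (a + b) ^ (k + 1) - (a - b) ^ (k + 1) ∧
    2 * a ^ (k + 2) + (k + 2) * (k + 1) * a ^ k * b ^ 2 ≤
      (a + b) ^ (k + 2) + (a - b) ^ (k + 2) := by
  induction k with
  | zero => exact ⟨by simp; linarith, by simp; linarith, by norm_num; nlinarith⟩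
  | succ k ih =>
    obtain ⟨h1, h2, h3⟩ := ih
    have d2 : 2 * ((k + 1 : ℕ) + 1 : ℝ) * a ^ (k + 1) * b ≤
        (a + b) ^ (k + 1 + 1) - (a - b) ^ (k + 1 + 1) := by
      have e1 := mul_le_mul_of_nonneg_left h2 ha
      have e2 := mul_le_mul_of_nonneg_left h1 hb
      push_cast
      ring_nf at e1 e2 ⊢
      linarith
    refine ⟨?_, d2, ?_⟩
    · have : 0 ≤ (k + 2) * (k + 1) * a ^ k * b ^ 2 := by positivity
      exact le_trans (by linarith) h3
    · have e1 := mul_le_mul_of_nonneg_left h3 ha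
      have e2 := mul_le_mul_of_nonneg_left d2 hb
      push_cast at e2 ⊢
      ring_nf at e1 e2 ⊢
      linarith

theorem one_third_le_pow (k : ℕ) : (1 : ℝ) / 3 ≤ (1 - 1 / ((k : ℝ) + 2)) ^ k := by
  have hk : (0 : ℝ) ≤ k := Nat.cast_nonneg k
  have e : 1 - 1 / ((k : ℝ) + 2) = (1 + 1 / ((k : ℝ) + 1))⁻¹ := by field_simp; ring
  have h1 : (1 + 1 / ((k : ℝ) + 1)) ^ k ≤ 3 := by
    calc (1 + 1 / ((k : ℝ) + 1)) ^ k ≤ Real.exp (1 / ((k : ℝ) + 1)) ^ k := by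
          refine pow_le_pow_left₀ (by positivity) ?_ k
          rw [add_comm]
          exact Real.add_one_le_exp _
      _ = Real.exp (k / ((k : ℝ) + 1)) := by rw [← Real.exp_nat_mul, mul_one_div]
      _ ≤ Real.exp 1 := by
          refine Real.exp_le_exp.2 ?_
          rw [div_le_one (by positivity)]
          linarith
      _ ≤ 3 := Real.exp_one_lt_three.le
  rw [e, inv_pow, one_div]
  exact inv_anti₀ (by positivity) h1

/-- A balanced perturbation of the uniform distribution lowers the expected number of distinct
elements: the expected number of missing elements goes up by at least `n τ² / 24`. -/
theorem missing_gap {n : ℕ} (hn : 2 ≤ n) {τ : ℝ} (hτ : 0 ≤ τ) (σ : Fin n → ℝ)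
    (hσ : ∀ x, σ x = -1 ∨ σ x = 0 ∨ σ x = 1) (hσ0 : ∑ x, σ x = 0)
    (hσ2 : (n : ℝ) - 1 ≤ ∑ x, σ x ^ 2) :
    n * τ ^ 2 / 24 ≤ ∑ x, (1 - (1 + τ * σ x) / n) ^ n - ∑ _x : Fin n, (1 - 1 / (n : ℝ)) ^ n := by
  obtain ⟨k, rfl⟩ : ∃ k, n = k + 2 := ⟨n - 2, by omega⟩
  set N : ℝ := ((k + 2 : ℕ) : ℝ) with hN
  have hNk : N = k + 2 := by rw [hN]; push_cast; ring
  have hk : (0 : ℝ) ≤ k := Nat.cast_nonneg k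
  have hN0 : 0 < N := by rw [hNk]; positivity
  set a : ℝ := 1 - 1 / N with ha
  set b : ℝ := τ / N with hb
  have ha0 : 0 ≤ a := by
    rw [ha, sub_nonneg, div_le_one hN0, hNk]; linarith
  have hb0 : 0 ≤ b := by positivity
  set G : ℝ := ((a + b) ^ (k + 2) + (a - b) ^ (k + 2)) / 2 - a ^ (k + 2) with hG
  -- Since `σ x` takes only the values `-1, 0, 1`, quadratic interpolation is exact. The linear term
  -- vanishes on summation by balance, and `G` is half the second difference.
  have hcell : ∀ x, (1 - (1 + τ * σ x) / N) ^ (k + 2) =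
      a ^ (k + 2) + σ x * (((a - b) ^ (k + 2) - (a + b) ^ (k + 2)) / 2) + σ x ^ 2 * G := by
    intro x
    have e : 1 - (1 + τ * σ x) / N = a - b * σ x := by rw [ha, hb]; ring
    rw [e, hG]
    rcases hσ x with h | h | h <;> rw [h] <;> ring
  have hGge : (k + 2) * (k + 1) * a ^ k * b ^ 2 / 2 ≤ G := by
    have := (add_pow_add_sub_pow_ge ha0 hb0 k).2.2
    rw [hG]; linarith
  have hak : 1 / 3 ≤ a ^ k := by rw [ha, hNk]; exact one_third_le_pow k
  have hG2 : (k + 1) * τ ^ 2 / (6 * N) ≤ G := by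
    refine le_trans ?_ hGge
    have h1 : (k + 1) * τ ^ 2 / (6 * N) = (k + 2) * (k + 1) * (1 / 3) * b ^ 2 / 2 := by
      rw [hb, hNk]; field_simp; ring
    rw [h1]
    gcongr
  simp only [hcell, Finset.sum_add_distrib, ← Finset.sum_mul, hσ0]
  have h2 : (N - 1) * ((k + 1) * τ ^ 2 / (6 * N)) ≤ (∑ x, σ x ^ 2) * G :=
    mul_le_mul hσ2 hG2 (by positivity) (by positivity)
  refine le_trans ?_ (h2.trans (le_of_eq (by ring)))
  rw [hNk]
  have h3 : (k + 2 - 1 : ℝ) * ((k + 1) * τ ^ 2 / (6 * (k + 2))) - (k + 2) * τ ^ 2 / 24 =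
      τ ^ 2 * (k * (3 * k + 4)) / (24 * (k + 2)) := by
    field_simp; ring
  have h4 : 0 ≤ τ ^ 2 * (k * (3 * k + 4)) / (24 * (k + 2)) := by positivity
  linarith

theorem card_image_le_of_neighboring {n : ℕ} {X : Type*} [DecidableEq X] {x x' : Fin n → X}
    (h : Neighboring x x') :
    (Finset.univ.image x').card ≤ (Finset.univ.image x).card + 1 ∧
      (Finset.univ.image x).card ≤ (Finset.univ.image x').card + 1 := by
  obtain ⟨σ, i, hi⟩ := h
  constructor
  · refine (Finset.card_le_card (t := insert (x' i) (Finset.univ.image x)) ?_).trans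
      (Finset.card_insert_le _ _)
    intro y hy
    obtain ⟨j, -, rfl⟩ := Finset.mem_image.1 hy
    by_cases hj : j = i
    · exact hj ▸ Finset.mem_insert_self _ _
    · rw [hi j hj]
      exact Finset.mem_insert_of_mem (Finset.mem_image_of_mem _ (Finset.mem_univ _))
  -- The only entry of `x` not matched with an entry of `x'` sits at index `σ i`.
  · refine (Finset.card_le_card (t := insert (x (σ i)) (Finset.univ.image x')) ?_).trans
      (Finset.card_insert_le _ _)
    intro y hy
    obtain ⟨j, -, rfl⟩ := Finset.mem_image.1 hy
    by_cases hj : σ.symm j = i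
    · rw [← hj, Equiv.apply_symm_apply]
      exact Finset.mem_insert_self _ _
    · refine Finset.mem_insert_of_mem (Finset.mem_image.2 ⟨σ.symm j, Finset.mem_univ _, ?_⟩)
      rw [hi _ hj, Equiv.apply_symm_apply]

theorem isGlobalSensitivity_countDistinct {n : ℕ} (hn : 2 ≤ n) :
    IsGlobalSensitivity (countDistinct n n) 1 := by
  refine IsGreatest.isLUB ⟨?_, ?_⟩
  · have h01 : (⟨0, by omega⟩ : Fin n) ≠ ⟨1, by omega⟩ := by simp
    refine ⟨fun _ => ⟨0, by omega⟩, fun j => if j = ⟨0, by omega⟩ then ⟨1, by omega⟩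
      else ⟨0, by omega⟩, ⟨1, ⟨0, by omega⟩, fun j hj => if_neg hj⟩, ?_⟩
    have e1 : Finset.univ.image (fun _ : Fin n => (⟨0, by omega⟩ : Fin n)) = {⟨0, by omega⟩} :=
      Finset.image_const ⟨⟨0, by omega⟩, Finset.mem_univ _⟩ _
    have e2 : Finset.univ.image (fun j : Fin n => if j = ⟨0, by omega⟩ then
        (⟨1, by omega⟩ : Fin n) else ⟨0, by omega⟩) = {⟨0, by omega⟩, ⟨1, by omega⟩} := by
      ext y
      simp only [Finset.mem_image, Finset.mem_univ, true_and, Finset.mem_insert,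
        Finset.mem_singleton]
      constructor
      · rintro ⟨j, rfl⟩
        split_ifs <;> simp
      · rintro (rfl | rfl)
        · exact ⟨⟨1, by omega⟩, if_neg h01.symm⟩
        · exact ⟨⟨0, by omega⟩, if_pos rfl⟩
    rw [countDistinct, countDistinct, e1, e2, Finset.card_singleton, Finset.card_pair h01]
    norm_num
  · rintro d ⟨x, x', h, rfl⟩
    obtain ⟨h1, h2⟩ := card_image_le_of_neighboring h
    have h1' : ((Finset.univ.image x').card : ℝ) ≤ (Finset.univ.image x).card + 1 := by
      exact_mod_cast h1
    have h2' : ((Finset.univ.image x).card : ℝ) ≤ (Finset.univ.image x').card + 1 := by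
      exact_mod_cast h2
    exact abs_sub_le_iff.2 ⟨by unfold countDistinct; linarith, by unfold countDistinct; linarith⟩

end DistinctCount

/-! ### Contradiction from the distinguishing test, and asymptotics -/

section LowerBound

variable {Γ : Type u} {M : Type v} [MeasurableSpace Γ] [MeasurableSpace M]

/-- The error lower bound, with explicit constants. -/
theorem not_solves_countDistinct {n : ℕ} (hn : 2 ≤ n) {ε δ err : ℝ} (hε : 0 ≤ ε)
    (hn2 : 400000000 * Real.exp ε ^ 2 ≤ n) (hδ : n * δ ≤ 1 / 16)
    (herr : err ≤ n / (16384 * Real.exp ε)) (P : Protocol n (Fin n) Γ M)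
    (hP : P.IsLocallyDP ε δ) : ¬ P.Solves (countDistinct n n) err := by
  intro hS
  have hn0 : (0 : ℝ) < n := by exact_mod_cast (by omega : 0 < n)
  obtain ⟨σ, hσ, hσ0, hσ2, hclose⟩ := exists_perturbation (by omega) P hε hδ hP
  set E := Real.exp ε with hE
  have hE0 : 0 < E := Real.exp_pos ε
  set τ := Real.exp (-ε / 2) / 8 with hτ
  have hτ0 : 0 < τ := by positivity
  have hτ1 : τ ≤ 1 / 8 := by
    have : Real.exp (-ε / 2) ≤ 1 := Real.exp_le_one_iff.2 (by linarith)
    rw [hτ]; linarith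
  have hτE : τ ^ 2 = 1 / (64 * E) := by
    have h1 : τ ^ 2 * E = 1 / 64 := by
      rw [hτ, hE, div_pow, ← Real.exp_nat_mul, div_mul_eq_mul_div, ← Real.exp_add]
      push_cast
      rw [show 2 * (-ε / 2) + ε = 0 by ring, Real.exp_zero]
      norm_num
    rw [eq_div_iff (by positivity)]
    linarith
  have hgap := missing_gap hn hτ0.le σ hσ hσ0 hσ2
  -- This is the mean gap `n * τ ^ 2 / 24` with `τ ^ 2 = 1 / (64 * E)`. Deviation of the count and
  -- error of the protocol are each kept within `Δ / 4`.
  set Δ : ℝ := n / (1536 * E) with hΔ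
  have hΔ0 : 0 < Δ := by positivity
  have hgapΔ : n * τ ^ 2 / 24 = Δ := by rw [hτE, hΔ]; field_simp; norm_num
  rw [hgapΔ] at hgap
  have herrΔ : err < Δ / 4 := by
    refine lt_of_le_of_lt herr ?_
    rw [hΔ, div_div]
    refine div_lt_div_of_pos_left hn0 (by positivity) ?_
    linarith
  have hcheb : (n : ℝ) / (Δ / 4) ^ 2 ≤ 1 / 10 := by
    have h1 : (n : ℝ) / (Δ / 4) ^ 2 = 37748736 * E ^ 2 / n := by
      rw [hΔ]; field_simp; norm_num
    rw [h1, div_le_iff₀ hn0]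
    linarith
  set p : Fin n → ℝ := fun y => (1 + τ * σ y) / n with hp
  set q : Fin n → ℝ := fun _ => 1 / (n : ℝ) with hq
  have hp0 : ∀ y, 0 ≤ p y := fun y => by
    refine div_nonneg ?_ hn0.le
    rcases hσ y with h | h | h <;> rw [h] <;> linarith
  have hp1 : ∑ y, p y = 1 := by
    simp only [hp, ← Finset.sum_div, Finset.sum_add_distrib, ← Finset.mul_sum, hσ0]
    simp [hn0.ne']
  have hq0 : ∀ y, 0 ≤ q y := fun y => by positivity
  have hq1 : ∑ y, q y = 1 := by simp [hq, hn0.ne']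
  have hdp := sum_deviation_le (n := n) p hp0 hp1 (t := Δ / 4) (by positivity)
  have hdq := sum_deviation_le (n := n) q hq0 hq1 (t := Δ / 4) (by positivity)
  set mp := ∑ y, (1 - p y) ^ n with hmp
  set mq := ∑ y, (1 - q y) ^ n with hmq
  have hgap' : Δ ≤ mp - mq := hgap
  -- The threshold lies `Δ / 2` below the uniform mean `n - mq` and at least `Δ / 2` above the
  -- perturbed mean `n - mp`. The test accepts with probability at least `0.99 - 0.1` in the first
  -- case and at most `0.01 + 0.1` in the second.
  set A : Set ℝ := Set.Ici (n - mq - Δ / 2) with hA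
  have hAm : MeasurableSet A := measurableSet_Ici
  have hop : ∀ x, IsProbabilityMeasure (P.output x) := fun x => by
    unfold Protocol.output Protocol.transcript; infer_instance
  have hlow : ∀ x, 0.99 - (if Δ / 4 ≤ |countDistinct n n x - (n - mq)| then (1 : ℝ) else 0) ≤
      (P.output x).real A := by
    intro x
    split_ifs with h
    · have := measureReal_nonneg (μ := P.output x) (s := A)
      linarith
    · rw [sub_zero]
      refine (hS x).trans (measureReal_mono fun z hz => ?_)
      have h1 := abs_le.1 (show |z - countDistinct n n x| ≤ err from hz)
      have h2 := abs_lt.1 (not_le.1 h)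
      change (n : ℝ) - mq - Δ / 2 ≤ z
      linarith [h1.1, h2.1]
  have hupp : ∀ x, (P.output x).real A ≤
      0.01 + (if Δ / 4 ≤ |countDistinct n n x - (n - mp)| then (1 : ℝ) else 0) := by
    intro x
    split_ifs with h
    · have := measureReal_le_one (μ := P.output x) (s := A)
      linarith
    · have h3 : {z | |z - countDistinct n n x| ≤ err} ⊆ Aᶜ := fun z hz => by
        have h1 := abs_le.1 (show |z - countDistinct n n x| ≤ err from hz)
        have h2 := abs_lt.1 (not_le.1 h)
        change ¬ ((n : ℝ) - mq - Δ / 2 ≤ z)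
        linarith [h1.2, h2.2]
      have h4 := (hS x).trans (measureReal_mono h3)
      rw [probReal_compl_eq_one_sub hAm] at h4
      linarith
  have hWp0 : ∀ x : Fin n → Fin n, 0 ≤ ∏ i, p (x i) :=
    fun x => Finset.prod_nonneg fun i _ => hp0 (x i)
  have hWp1 : ∑ x : Fin n → Fin n, ∏ i, p (x i) = 1 := by rw [← Fintype.sum_pow, hp1, one_pow]
  have hWq0 : ∀ x : Fin n → Fin n, 0 ≤ ∏ i, q (x i) :=
    fun x => Finset.prod_nonneg fun i _ => hq0 (x i)
  have hWq1 : ∑ x : Fin n → Fin n, ∏ i, q (x i) = 1 := by rw [← Fintype.sum_pow, hq1, one_pow]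
  have hTq : 0.89 ≤ ∑ x : Fin n → Fin n, (∏ i, q (x i)) * (P.output x).real A := by
    have h1 := Finset.sum_le_sum fun x (_ : x ∈ Finset.univ) =>
      mul_le_mul_of_nonneg_left (hlow x) (hWq0 x)
    simp only [mul_sub, Finset.sum_sub_distrib, ← Finset.sum_mul, hWq1] at h1
    linarith
  have hTp : ∑ x : Fin n → Fin n, (∏ i, p (x i)) * (P.output x).real A ≤ 0.11 := by
    have h1 := Finset.sum_le_sum fun x (_ : x ∈ Finset.univ) =>
      mul_le_mul_of_nonneg_left (hupp x) (hWp0 x)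
    simp only [mul_add, Finset.sum_add_distrib, ← Finset.sum_mul, hWp1] at h1
    linarith
  have hc : |∑ x : Fin n → Fin n, (∏ i, p (x i)) * (P.output x).real A -
      ∑ x : Fin n → Fin n, (∏ i, q (x i)) * (P.output x).real A| ≤ 1 / 2 := hclose A hAm
  have := (abs_le.1 hc).1
  norm_num at hTq hTp
  linarith

/-- Chebyshev needs `n` to dominate a multiple of `e ^ (2 ε)`. As `0.49 < 1 / 2`, the latter is at
most `n ^ 0.98`, and the spare `n ^ 0.02` absorbs the constant. -/
theorem eventually_exp_sq_le :
    ∀ᶠ n : ℕ in atTop, ∀ ε : ℝ, ε ≤ 0.49 * Real.log n → 400000000 * Real.exp ε ^ 2 ≤ n := by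
  have h := ((tendsto_rpow_atTop (by norm_num : (0 : ℝ) < 0.02)).comp
    (tendsto_natCast_atTop_atTop (R := ℝ))).eventually_ge_atTop 400000000
  filter_upwards [h, eventually_gt_atTop 0] with n hn hn0 ε hε
  have hn0' : (0 : ℝ) < n := by exact_mod_cast hn0
  have h1 : Real.exp ε ^ 2 ≤ (n : ℝ) ^ (0.98 : ℝ) := by
    rw [← Real.exp_nat_mul, Real.rpow_def_of_pos hn0']
    refine Real.exp_le_exp.2 ?_
    push_cast
    linarith
  calc 400000000 * Real.exp ε ^ 2 ≤ (n : ℝ) ^ (0.02 : ℝ) * (n : ℝ) ^ (0.98 : ℝ) :=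
        mul_le_mul hn h1 (by positivity) (by positivity)
    _ = n := by
        rw [← Real.rpow_add hn0']
        norm_num

theorem exists_lower_bound :
    ∃ c : ℝ, 0 < c ∧ ∃ N : ℕ, ∀ n : ℕ, N ≤ n →
      ∀ ε : ℝ, 0 ≤ ε → ε ≤ 0.49 * Real.log n →
        ∀ (Γ : Type u) [MeasurableSpace Γ] (M : Type v) [MeasurableSpace M]
          (P : Protocol n (Fin n) Γ M),
          P.IsLocallyDP ε (c / n) →
            ¬ P.Solves (countDistinct n n) (c * (n / Real.exp ε)) := by
  obtain ⟨N, hN⟩ := eventually_atTop.1 eventually_exp_sq_le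
  refine ⟨1 / 16384, by norm_num, max N 2, fun n hn ε hε hε2 Γ _ M _ P hP => ?_⟩
  have hn2 : 2 ≤ n := (le_max_right _ _).trans hn
  have hn0 : (0 : ℝ) < n := by exact_mod_cast (by omega : 0 < n)
  refine not_solves_countDistinct hn2 hε (hN n ((le_max_left _ _).trans hn) ε hε2) ?_ ?_ P hP
  · rw [mul_div_cancel₀ _ hn0.ne']
    norm_num
  · exact le_of_eq (by field_simp)

theorem Protocol.IsLocallyDP.mono {n : ℕ} {X : Type*} {P : Protocol n X Γ M} {ε δ δ' : ℝ}
    (hP : P.IsLocallyDP ε δ) (h : δ ≤ δ') : P.IsLocallyDP ε δ' :=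
  fun x x' hx S hS => (hP x x' hx S hS).trans (by linarith)

theorem Protocol.Solves.mono {n : ℕ} {X : Type*} {P : Protocol n X Γ M} {f : (Fin n → X) → ℝ}
    {e e' : ℝ} (hP : P.Solves f e) (h : e ≤ e') : P.Solves f e' := fun x => by
  have : IsProbabilityMeasure (P.output x) := by
    unfold Protocol.output Protocol.transcript; infer_instance
  exact (hP x).trans (measureReal_mono fun z (hz : |z - f x| ≤ e) => hz.trans h)

end LowerBound
end LocalDP

theorem theorem1 :
    -- for `ε = O(1)`, no `(ε, o(1/n))`-locally private protocol has error `o(n)`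
    (∀ ε δ err : ℕ → ℝ,
      (∀ n, 0 ≤ ε n) →
      (ε =O[atTop] fun _ => (1 : ℝ)) →
      (δ =o[atTop] fun n => 1 / (n : ℝ)) →
      (err =o[atTop] fun n => (n : ℝ)) →
      ∀ᶠ n : ℕ in atTop,
        ∀ (Γ : Type u) [MeasurableSpace Γ] (M : Type v) [MeasurableSpace M]
          (P : LocalDP.Protocol n (Fin n) Γ M),
          P.IsLocallyDP (ε n) (δ n) → ¬ P.Solves (LocalDP.countDistinct n n) (err n)) ∧
    -- uniformly for `0 ≤ ε ≤ 0.49 ln n`, the error is `Ω(n / e ^ ε)`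
    (∃ c : ℝ, 0 < c ∧ ∃ N : ℕ, ∀ n : ℕ, N ≤ n →
      ∀ ε : ℝ, 0 ≤ ε → ε ≤ 0.49 * Real.log n →
        ∀ (Γ : Type u) [MeasurableSpace Γ] (M : Type v) [MeasurableSpace M]
          (P : LocalDP.Protocol n (Fin n) Γ M),
          P.IsLocallyDP ε (c / n) →
            ¬ P.Solves (LocalDP.countDistinct n n) (c * (n / Real.exp ε))) ∧
    -- while the global sensitivity is `1`
    (∀ n : ℕ, 2 ≤ n → LocalDP.IsGlobalSensitivity (LocalDP.countDistinct n n) 1) := by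
  refine ⟨fun ε δ err hε hεO hδ herr => ?_, LocalDP.exists_lower_bound,
    fun n hn => LocalDP.isGlobalSensitivity_countDistinct hn⟩
  obtain ⟨c, hc, N, hN⟩ := LocalDP.exists_lower_bound.{u, v}
  obtain ⟨C, hC⟩ := hεO.bound
  have hlog := (Real.tendsto_log_atTop.comp
    (tendsto_natCast_atTop_atTop (R := ℝ))).eventually_ge_atTop (C / 0.49)
  -- With `ε n ≤ C` eventually, the error bound `c * n / e ^ C` is below `c * n / e ^ (ε n)`, and `C
  -- ≤ 0.49 * log n` for large `n`, so the uniform bound applies.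
  filter_upwards [hC, hδ.def hc, herr.def (div_pos hc (Real.exp_pos C)), hlog,
    eventually_ge_atTop N] with n hCn hδn herrn hlogn hn Γ _ M _ P hP hS
  rw [Real.norm_of_nonneg (hε n), norm_one, mul_one] at hCn
  have hlogn' : C ≤ 0.49 * Real.log n := by
    have := (div_le_iff₀ (by norm_num)).1 hlogn
    rw [mul_comm]
    exact this
  have hδn' : δ n ≤ c / n := by
    refine (Real.le_norm_self _).trans (hδn.trans (le_of_eq ?_))
    rw [Real.norm_of_nonneg (by positivity), mul_one_div]
  have herrn' : err n ≤ c * (n / Real.exp (ε n)) := by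
    refine (Real.le_norm_self _).trans (herrn.trans ?_)
    rw [Real.norm_of_nonneg (Nat.cast_nonneg n), div_mul_eq_mul_div, mul_div_assoc]
    gcongr
  exact hN n hn (ε n) (hε n) (hCn.trans hlogn') Γ M P (hP.mono hδn') (hS.mono herrn')
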